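/- A $d$-dimensional structured game with $n\ge 1$ actions for the Learner and $n'$ actions for the Adversary is given by vectors $v_1,\dots,v_n,w_1,\dots,w_{n'}\in\mathbb{R}^d$ of Euclidean norm at most $1$; when the Learner plays $i$ and the Adversary plays $j$, the Learner's payoff is $u_L(i,j)=\langle v_i,w_j\rangle$, extended bilinearly to mixed actions $p\in\Delta_n$, $q\in\Delta_{n'}$. Write $\mathcal K=\mathrm{conv}\{v_1,\dots,v_n\}$. The game is played for $T$ rounds. A learning algorithm is a family of maps $\mathcal A_t$ $(1\le t\le T)$ that send the Adversary's previous mixed actions $q_1,\dots,q_{t-1}$ to the Learner's mixed action $p_t\in\Delta_n$, and its swap regret is $$\mathrm{SwapReg}(p_{1:T},q_{1:T})=\max_{\phi:[n]\to[n]}\ \sum_{t=1}^T\bigl(u_L(\phi(p_t),q_t)-u_L(p_t,q_t)\bigr),$$ where $\phi$ acts linearly on $\Delta_n$. A convex decomposition oracle is a fixed map that sends each $x\in\mathcal K$ to some $p\in\Delta_n$ with $\sum_i p_iv_i=x$, written out as a list of (action, probability) pairs; it is efficient if it runs in time $\mathrm{poly}(d)$. **Theorem.** There are an absolute constant $C>0$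 and a single real-RAM program such that the following holds for all $d$, $T$ and every $d$-dimensional structured game. There is a list of at most $\mathrm{poly}(d,T)$ points of $\mathcal K$ (a discretization of $\mathcal K$) such that the program, started with $d$, $T$ and this list in its memory, run once per round, told after each round the embedding $\sum_j q_{t,j}w_j$ of the Adversary's mixed action, and given any convex decomposition oracle, implements a learning algorithm for the Learner with the following properties. 1. For all $q_1,\dots,q_T\in\Delta_{n'}$ (that is, against any Adversary), $$\mathrm{SwapReg}(p_{1:T},q_{1:T})\le C\,T^{(d+1)/(d+3)}\log(T+1).$$ 2. For every $\varepsilon\in(0,1]$, if $T\ge\bigl(\tfrac{C}{\varepsilon}\log\tfrac{2}{\varepsilon}\bigr)^{(d+3)/2}$, then $\mathrm{SwapReg}(p_{1:T},q_{1:T})\le\varepsilon T$ for all $q_1,\dots,q_T\in\Delta_{n'}$. 3. If the oracle is efficient, the running time of the program in each round, including the oracle calls, is at most $\mathrm{poly}(d,T)$; the polynomial depends only on the polynomial that bounds the oracle's running time. -/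

import Mathlib

/-! ### Structured games, learning algorithms, swap regret -/

/-- The embeddings of a `d`-dimensional structured game with `n` actions for the Learner and `n'`
actions for the Adversary; all embeddings have Euclidean norm at most `1`. The Adversary's own
payoff plays no role for the Learner's regret and is left arbitrary. -/
structure StructuredGame (d n n' : ℕ) where
  v : Fin n → EuclideanSpace ℝ (Fin d)
  w : Fin n' → EuclideanSpace ℝ (Fin d)
  norm_v_le : ∀ i, ‖v i‖ ≤ 1
  norm_w_le : ∀ j, ‖w j‖ ≤ 1

namespace StructuredGame

variable {d n n' : ℕ}

/-- The Learner's payoff on pure actions. -/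
noncomputable def uL (G : StructuredGame d n n') (i : Fin n) (j : Fin n') : ℝ :=
  inner ℝ (G.v i) (G.w j)

/-- The Learner's expected payoff on mixed actions. -/
noncomputable def uLMixed (G : StructuredGame d n n') (p : Fin n → ℝ) (q : Fin n' → ℝ) : ℝ :=
  ∑ i, ∑ j, p i * q j * G.uL i j

/-- The convex hull `K` of the embeddings of the Learner's actions. -/
def K (G : StructuredGame d n n') : Set (EuclideanSpace ℝ (Fin d)) :=
  convexHull ℝ (Set.range G.v)

/-- The embedding `π'(q)` of a mixed action of the Adversary. -/
noncomputable def embedAdv (G : StructuredGame d n n') (q : Fin n' → ℝ) :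
    EuclideanSpace ℝ (Fin d) :=
  ∑ j, q j • G.w j

end StructuredGame

/-- The linear extension of a swap function to mixed actions. -/
def swapMixed {n : ℕ} (φ : Fin n → Fin n) (p : Fin n → ℝ) : Fin n → ℝ :=
  fun j => ∑ i, if φ i = j then p i else 0

/-- Swap regret of the transcript `p_1, …, p_T`, `q_1, …, q_T` (a maximum over the finite nonempty
set of all swap functions). -/
noncomputable def StructuredGame.swapRegret {d n n' T : ℕ} (G : StructuredGame d n n')
    (p : Fin T → stdSimplex ℝ (Fin n)) (q : Fin T → stdSimplex ℝ (Fin n')) : ℝ :=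
  ⨆ φ : Fin n → Fin n, ∑ t, (G.uLMixed (swapMixed φ (p t)) (q t) - G.uLMixed (p t) (q t))

/-- A learning algorithm for `T` rounds: in round `t` the mixed actions that the Adversary has
played in the previous rounds are mapped to a mixed action of the Learner. -/
def LearningAlgorithm (n n' T : ℕ) : Type :=
  (t : Fin T) → (Fin t → stdSimplex ℝ (Fin n')) → stdSimplex ℝ (Fin n)

/-- The Learner's actions when the Adversary plays `q_1, …, q_T`. -/
def LearningAlgorithm.play {n n' T : ℕ} (A : LearningAlgorithm n n' T)
    (q : Fin T → stdSimplex ℝ (Fin n')) (t : Fin T) : stdSimplex ℝ (Fin n) :=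
  A t (fun s => q ⟨s, s.2.trans t.2⟩)

/-- A convex decomposition oracle: a fixed map that sends each `x ∈ K` to a mixed action embedding
to `x`, written as a list of pairs (action, probability), together with its running time, which is
at least the length of the answer. Nothing is assumed about queries outside `K`. -/
structure DecompositionOracle {d n n' : ℕ} (G : StructuredGame d n n') where
  answer : EuclideanSpace ℝ (Fin d) → List (Fin n × ℝ)
  time : EuclideanSpace ℝ (Fin d) → ℕ
  nonneg : ∀ x ∈ G.K, ∀ e ∈ answer x, 0 ≤ e.2
  sum_eq_one : ∀ x ∈ G.K, ((answer x).map fun e => e.2).sum = 1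
  embed_eq : ∀ x ∈ G.K, ((answer x).map fun e => e.2 • G.v e.1).sum = x
  length_le : ∀ x ∈ G.K, (answer x).length ≤ time x

/-- Every structured game has a decomposition oracle (of no particular efficiency). -/
theorem DecompositionOracle.exists_oracle {d n n' : ℕ} (G : StructuredGame d n n') :
    Nonempty (DecompositionOracle G) := by
  classical
  have key : ∀ x : EuclideanSpace ℝ (Fin d), ∃ l : List (Fin n × ℝ), x ∈ G.K →
      (∀ e ∈ l, 0 ≤ e.2) ∧ (l.map fun e => e.2).sum = 1 ∧
        (l.map fun e => e.2 • G.v e.1).sum = x := by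
    intro x
    by_cases hx : x ∈ G.K
    · have hx' := hx
      rw [StructuredGame.K, mem_convexHull_iff_exists_fintype] at hx'
      obtain ⟨ι, _, c, z, h0, h1, hz, h2⟩ := hx'
      choose f hf using hz
      refine ⟨(Finset.univ : Finset ι).toList.map fun i => (f i, c i), fun _ => ⟨?_, ?_, ?_⟩⟩
      · simpa using h0
      · simpa [List.map_map, Function.comp_def] using h1
      · simpa [List.map_map, Function.comp_def, hf] using h2
    · exact ⟨[], fun h => absurd h hx⟩
  choose l hl using key
  exact ⟨{
    answer := l
    time := fun x => (l x).length
    nonneg := fun x hx => (hl x hx).1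
    sum_eq_one := fun x hx => (hl x hx).2.1
    embed_eq := fun x hx => (hl x hx).2.2
    length_le := fun _ _ => le_rfl }⟩

/-! ### Real-RAM programs with a step count

Memory consists of natural-number cells and real cells; every cell is addressed by a constant array
name and two computed indices. Each arithmetic operation, comparison, memory access and output
costs one step. On natural numbers there are only `+` and truncated `-` (no multiplication), on
reals there are `+`, `-`, `*`, `/`, the constants obtained from natural numbers, and comparison;
there is no rounding from reals to natural numbers. Control flow is by sequencing, conditionals and
counted loops, so every program terminates. -/

namespace RealRAM

structure Store where
  nat : ℕ → ℕ → ℕ → ℕ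
  real : ℕ → ℕ → ℕ → ℝ
  /-- The output of the current round: pairs (action, weight). -/
  out : List (ℕ × ℝ)

namespace Store

def setNat (s : Store) (a i j k : ℕ) : Store :=
  { s with nat := fun a' i' j' => if a' = a ∧ i' = i ∧ j' = j then k else s.nat a' i' j' }

noncomputable def setReal (s : Store) (a i j : ℕ) (x : ℝ) : Store :=
  { s with real := fun a' i' j' => if a' = a ∧ i' = i ∧ j' = j then x else s.real a' i' j' }

end Store

inductive NExp where
  | const (k : ℕ)
  | get (a : ℕ) (i j : NExp)
  | add (e f : NExp)
  | sub (e f : NExp)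

namespace NExp

def eval (s : Store) : NExp → ℕ
  | const k => k
  | get a i j => s.nat a (i.eval s) (j.eval s)
  | add e f => e.eval s + f.eval s
  | sub e f => e.eval s - f.eval s

def cost : NExp → ℕ
  | const _ => 1
  | get _ i j => i.cost + j.cost + 1
  | add e f => e.cost + f.cost + 1
  | sub e f => e.cost + f.cost + 1

end NExp

inductive RExp where
  | ofNat (e : NExp)
  | get (a : ℕ) (i j : NExp)
  | add (e f : RExp)
  | sub (e f : RExp)
  | mul (e f : RExp)
  | div (e f : RExp)

namespace RExp

noncomputable def eval (s : Store) : RExp → ℝ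
  | ofNat e => (e.eval s : ℝ)
  | get a i j => s.real a (i.eval s) (j.eval s)
  | add e f => e.eval s + f.eval s
  | sub e f => e.eval s - f.eval s
  | mul e f => e.eval s * f.eval s
  | div e f => e.eval s / f.eval s

def cost : RExp → ℕ
  | ofNat e => e.cost + 1
  | get _ i j => i.cost + j.cost + 1
  | add e f => e.cost + f.cost + 1
  | sub e f => e.cost + f.cost + 1
  | mul e f => e.cost + f.cost + 1
  | div e f => e.cost + f.cost + 1

end RExp

/-- Tests: strict comparison of two natural numbers or of two reals. -/
inductive Test where
  | ltNat (e f : NExp)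
  | ltReal (e f : RExp)

namespace Test

def holds (s : Store) : Test → Prop
  | ltNat e f => e.eval s < f.eval s
  | ltReal e f => e.eval s < f.eval s

def cost : Test → ℕ
  | ltNat e f => e.cost + f.cost + 1
  | ltReal e f => e.cost + f.cost + 1

end Test

inductive Cmd where
  | skip
  | setNat (a : ℕ) (i j e : NExp)
  | setReal (a : ℕ) (i j : NExp) (e : RExp)
  /-- Append the pair (action `e`, weight `r`) to the output. -/
  | emit (e : NExp) (r : RExp)
  /-- Call the oracle on the vector stored in row `i` of real array `a`, and write the answer
  to array `b`. -/
  | query (a : ℕ) (i : NExp) (b : ℕ)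
  | seq (c₁ c₂ : Cmd)
  | ite (t : Test) (c₁ c₂ : Cmd)
  /-- `for x = 0, …, e - 1 do c`, with the counter in the natural-number cell `(x, 0, 0)`; the
  number of iterations is fixed on entry. -/
  | loop (x : ℕ) (e : NExp) (c : Cmd)

/-- The vector in the first `d` columns of row `i` of real array `a`. -/
noncomputable def Store.vec (s : Store) (d a i : ℕ) : EuclideanSpace ℝ (Fin d) :=
  WithLp.toLp 2 fun k : Fin d => s.real a i k

/-- Write a list of pairs to array `b`: its length to the natural-number cell `(b, 0, 0)`, and the
two components of its `k`-th entry (`k = 1, 2, …`) to the natural-number and the real cell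
`(b, k, 0)`. -/
noncomputable def Store.writeList (s : Store) (b : ℕ) (l : List (ℕ × ℝ)) : Store :=
  { s with
    nat := fun a i j =>
      if a = b ∧ j = 0 ∧ i = 0 then l.length
      else if a = b ∧ j = 0 ∧ i ≤ l.length then (l.getD (i - 1) (0, 0)).1
      else s.nat a i j
    real := fun a i j =>
      if a = b ∧ j = 0 ∧ 0 < i ∧ i ≤ l.length then (l.getD (i - 1) (0, 0)).2
      else s.real a i j }

open Classical in
/-- Final store and number of steps of a program with access to an oracle `Q` on `ℝ^d`, which
returns an answer and the time spent on it. -/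
noncomputable def Cmd.run {d : ℕ} (Q : EuclideanSpace ℝ (Fin d) → List (ℕ × ℝ) × ℕ) :
    Cmd → Store → Store × ℕ
  | skip, s => (s, 1)
  | setNat a i j e, s =>
      (s.setNat a (i.eval s) (j.eval s) (e.eval s), i.cost + j.cost + e.cost + 1)
  | setReal a i j e, s =>
      (s.setReal a (i.eval s) (j.eval s) (e.eval s), i.cost + j.cost + e.cost + 1)
  | emit e r, s =>
      ({ s with out := s.out ++ [(e.eval s, r.eval s)] }, e.cost + r.cost + 1)
  | query a i b, s =>
      let ans := Q (s.vec d a (i.eval s))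
      (s.writeList b ans.1, i.cost + d + ans.2 + 1)
  | seq c₁ c₂, s =>
      let r₁ := c₁.run Q s
      let r₂ := c₂.run Q r₁.1
      (r₂.1, r₁.2 + r₂.2)
  | ite t c₁ c₂, s =>
      let r := if t.holds s then c₁.run Q s else c₂.run Q s
      (r.1, t.cost + r.2)
  | loop x e c, s =>
      (List.range (e.eval s)).foldl
        (fun acc k =>
          let r := c.run Q (acc.1.setNat x 0 0 k)
          (r.1, acc.2 + r.2 + 1))
        (s, e.cost + 1)

/-- The initial store. Natural-number array `0` holds the dimension `d`, the horizon `T` and the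
number `N` of points of the discretization; real array `0` holds these points, one per row; all
other cells are zero. -/
noncomputable def initStore {d N : ℕ} (T : ℕ) (Z : Fin N → EuclideanSpace ℝ (Fin d)) : Store where
  nat := fun a i j =>
    if a = 0 ∧ i = 0 then (if j = 0 then d else if j = 1 then T else if j = 2 then N else 0) else 0
  real := fun a i j =>
    if h : a = 0 ∧ i < N ∧ j < d then Z ⟨i, h.2.1⟩ ⟨j, h.2.2⟩ else 0
  out := []

/-- At the end of a round the embedding of the Adversary's mixed action is written to row `0` of
real array `1`, and the output is cleared. -/
noncomputable def Store.observe {d : ℕ} (s : Store) (y : EuclideanSpace ℝ (Fin d)) : Store where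
  nat := s.nat
  real := fun a i j => if h : a = 1 ∧ i = 0 ∧ j < d then y ⟨j, h.2.2⟩ else s.real a i j
  out := []

/-- The store at the beginning of a round, when the program `P` has been run once in every previous
round and the embeddings `ys` have been observed, in this order. -/
noncomputable def storeAfter {d : ℕ} (P : Cmd)
    (Q : EuclideanSpace ℝ (Fin d) → List (ℕ × ℝ) × ℕ) (s₀ : Store)
    (ys : List (EuclideanSpace ℝ (Fin d))) : Store :=
  ys.foldl (fun s y => (P.run Q s).1.observe y) s₀

/-- A list of pairs (action, weight) represents the mixed action `p`. -/
def Represents {n : ℕ} (l : List (ℕ × ℝ)) (p : Fin n → ℝ) : Prop :=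
  (∀ e ∈ l, e.1 < n) ∧ ∀ i : Fin n, p i = ((l.filter fun e => e.1 = i.val).map fun e => e.2).sum

end RealRAM

/-- A decomposition oracle as seen by a program. -/
def DecompositionOracle.toQuery {d n n' : ℕ} {G : StructuredGame d n n'}
    (D : DecompositionOracle G) (x : EuclideanSpace ℝ (Fin d)) : List (ℕ × ℝ) × ℕ :=
  ((D.answer x).map fun e => (e.1.val, e.2), D.time x)

/-- Run once per round on the observed embeddings, from the discretization `Z` in memory, and with
the oracle `D`, the program `P` outputs exactly the mixed actions of the learning algorithm `A`. -/
def RealRAM.Implements {d n n' T N : ℕ} {G : StructuredGame d n n'} (P : RealRAM.Cmd)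
    (D : DecompositionOracle G) (Z : Fin N → EuclideanSpace ℝ (Fin d))
    (A : LearningAlgorithm n n' T) : Prop :=
  ∀ (t : Fin T) (h : Fin t → stdSimplex ℝ (Fin n')),
    RealRAM.Represents
      (P.run D.toQuery (RealRAM.storeAfter P D.toQuery (RealRAM.initStore T Z)
        (List.ofFn fun s => G.embedAdv (h s)))).1.out
      (A t h : Fin n → ℝ)

/-- In every round, and for every history, the program `P` takes at most `B` steps (including the
time spent by the oracle). -/
def RealRAM.RoundTimeLE {d n n' N : ℕ} {G : StructuredGame d n n'} (P : RealRAM.Cmd)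
    (D : DecompositionOracle G) (Z : Fin N → EuclideanSpace ℝ (Fin d)) (T B : ℕ) : Prop :=
  ∀ (t : Fin T) (h : Fin t → stdSimplex ℝ (Fin n')),
    (P.run D.toQuery (RealRAM.storeAfter P D.toQuery (RealRAM.initStore T Z)
        (List.ofFn fun s => G.embedAdv (h s)))).2 ≤ B

/-! ### Approximating a polytope by few of its vertices -/

/-! The exponent comes from balancing two errors. Put `r = T^(1/(d+3))`.

Discretization. About `r^(d-1)` of the vertices of `K` suffice for the support function to be
correct up to `O(r⁻²) ‖S‖` in every direction `S` (`exists_small_support_net`). The error is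
quadratic in the mesh because the net is taken on a sphere of radius `2` onto which vertices are
pushed along directions that they maximize; that the sphere has dimension `d - 1` gives the exponent
(`card_le_of_separated_sphere`).

Swap regret on the points. For `N` points one copy of multiplicative weights is run per point, copy
`i` receiving the gains scaled by the weight `μ_t(i)` with which point `i` is played. If `μ_t` is
nearly stationary for the matrix of the copies' distributions, the regrets of the copies add up to
the swap regret on the points, of order `√(N T) log N` for the right learning rate
(`swap_regret_of_nearly_stationary`). An exactly stationary distribution is not needed: the average
of the first `T` steps of the Markov chain has defect at most `2 / T`
(`averagedWalk_nearly_stationary`).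

Transfer to actions. The oracle is a fixed map, so a swap function moves all the weight ever put on
the point `z_k` to one and the same `x_k ∈ K`. Against `S_k = ∑_t μ_t(k) y_t`, where `y_t` embeds
the Adversary's action, `x_k` is better than the best point of the discretization by at most `ε
‖S_k‖`, and `∑_k ‖S_k‖ ≤ T`. So the swap regret exceeds that on the points by at most `ε T`
(`swapRegret_learner_le`).

With `N` of order `r^(d-1)` and `ε` of order `r⁻²`, both `√(N T)` and `ε T` are of order `r^(d+1) =
T^((d+1)/(d+3))`. The factors depending on `d` are absorbed by taking the mesh `24 / r`, which makes
`N` smaller by a factor exponential in `d`; hence the constant is absolute.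

The program is verified by rules for `Spec`, which bound the number of steps along with the final
store; its memory is shown to follow `stateAfter`. -/

/-- A `δ`-separated subset of the unit sphere of `ℝ^d` has at most `2d(3/δ)^(d-1)` points. -/
theorem card_le_of_separated_sphere {d : ℕ} (hd : 0 < d) {δ : ℝ} (hδ : 0 < δ) (hδ1 : δ ≤ 1)
    (s : Finset (EuclideanSpace ℝ (Fin d))) (hs : ∀ x ∈ s, ‖x‖ = 1)
    (hsep : ∀ x ∈ s, ∀ y ∈ s, x ≠ y → δ ≤ dist x y) :
    (s.card : ℝ) ≤ 2 * d * (3 / δ) ^ (d - 1) := by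
  classical
  obtain ⟨m, rfl⟩ : ∃ m, d = m + 1 := ⟨d - 1, by omega⟩
  set μ := (MeasureTheory.volume : MeasureTheory.Measure (EuclideanSpace ℝ (Fin (m + 1))))
  set h := δ / 2 with hh
  have h0 : 0 < h := by positivity
  have h1 : h ≤ 1 / 2 := by linarith
  have hdisj : (s : Set (EuclideanSpace ℝ (Fin (m + 1)))).PairwiseDisjoint
      (fun x => Metric.ball x h) := by
    intro x hx y hy hxy
    refine Metric.ball_disjoint_ball ?_
    have := hsep x hx y hy hxy
    linarith
  -- The disjoint balls lie in a shell of thickness `2h`. Its volume is linear in `h`, which lowers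
  -- the exponent from `d` to `d - 1`.
  have hsub : (⋃ x ∈ s, Metric.ball x h) ⊆
      Metric.ball 0 (1 + h) \ Metric.closedBall 0 (1 - h) := by
    intro y hy
    simp only [Set.mem_iUnion, exists_prop] at hy
    obtain ⟨x, hx, hyx⟩ := hy
    rw [Metric.mem_ball, dist_eq_norm] at hyx
    have hx1 := hs x hx
    have t1 : ‖y‖ ≤ ‖y - x‖ + ‖x‖ := by simpa using norm_add_le (y - x) x
    have t2 : ‖x‖ ≤ ‖y - x‖ + ‖y‖ := by
      have := norm_sub_le y (y - x)
      simp only [sub_sub_cancel] at this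
      linarith
    simp only [Set.mem_sdiff, Metric.mem_ball, Metric.mem_closedBall, dist_zero_right]
    constructor
    · linarith
    · intro h3; linarith
  have hfin : Module.finrank ℝ (EuclideanSpace ℝ (Fin (m + 1))) = m + 1 := by simp
  have hB : ∀ (x : EuclideanSpace ℝ (Fin (m + 1))) (r : ℝ), 0 ≤ r →
      μ.real (Metric.ball x r) = r ^ (m + 1) * μ.real (Metric.ball 0 1) := by
    intro x r hr
    rw [MeasureTheory.measureReal_def, MeasureTheory.Measure.addHaar_ball μ x hr, hfin,
      ENNReal.toReal_mul, ENNReal.toReal_ofReal (by positivity), MeasureTheory.measureReal_def]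
  have hC : μ.real (Metric.closedBall 0 (1 - h)) =
      (1 - h) ^ (m + 1) * μ.real (Metric.ball 0 1) := by
    rw [← hB 0 (1 - h) (by linarith), MeasureTheory.measureReal_def, MeasureTheory.measureReal_def,
      MeasureTheory.Measure.addHaar_closedBall_eq_addHaar_ball]
  have hpos : 0 < μ.real (Metric.ball (0 : EuclideanSpace ℝ (Fin (m + 1))) 1) :=
    ENNReal.toReal_pos (Metric.measure_ball_pos μ 0 one_pos).ne'
      Metric.isBounded_ball.measure_lt_top.ne
  have hU : μ.real (⋃ x ∈ s, Metric.ball x h) =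
      s.card * (h ^ (m + 1) * μ.real (Metric.ball 0 1)) := by
    rw [MeasureTheory.measureReal_biUnion_finset hdisj (fun x _ => measurableSet_ball)]
    simp [hB _ h h0.le]
  have hle : μ.real (⋃ x ∈ s, Metric.ball x h) ≤
      μ.real (Metric.ball 0 (1 + h)) - μ.real (Metric.closedBall 0 (1 - h)) := by
    rw [← MeasureTheory.measureReal_sdiff
      ((Metric.closedBall_subset_ball (by linarith))) Metric.isClosed_closedBall.measurableSet]
    exact MeasureTheory.measureReal_mono hsub
      (ne_top_of_le_ne_top Metric.isBounded_ball.measure_lt_top.ne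
        (MeasureTheory.measure_mono Set.sdiff_subset))
  rw [hU, hC, hB 0 (1 + h) (by linarith)] at hle
  have hle2 : (s.card : ℝ) * h ^ (m + 1) ≤ (1 + h) ^ (m + 1) - (1 - h) ^ (m + 1) := by
    have : (s.card * h ^ (m + 1)) * μ.real (Metric.ball 0 1) ≤
        ((1 + h) ^ (m + 1) - (1 - h) ^ (m + 1)) * μ.real (Metric.ball 0 1) := by
      linarith
    exact le_of_mul_le_mul_right this hpos
  have hbern : (1 + h) ^ (m + 1) - (1 - h) ^ (m + 1) ≤ 2 * h * (m + 1 : ℕ) * (1 + h) ^ m := by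
    -- Bernoulli's inequality for `(1 - h) / (1 + h)` extracts the factor `h` from the volume of the
    -- shell.
    have hb := one_add_mul_le_pow (a := -(2 * h) / (1 + h)) (by
      rw [le_div_iff₀ (by linarith)]; linarith) (m + 1)
    have e1 : 1 + -(2 * h) / (1 + h) = (1 - h) / (1 + h) := by field_simp; ring
    rw [e1, div_pow, le_div_iff₀ (by positivity)] at hb
    have e2 : (1 + ((m + 1 : ℕ) : ℝ) * (-(2 * h) / (1 + h))) * (1 + h) ^ (m + 1) =
        (1 + h) ^ (m + 1) - 2 * h * (m + 1 : ℕ) * (1 + h) ^ m := by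
      field_simp; ring
    linarith
  have hfinal : (s.card : ℝ) * h ^ m ≤ 2 * (m + 1 : ℕ) * (1 + h) ^ m := by
    have : ((s.card : ℝ) * h ^ m) * h ≤ (2 * (m + 1 : ℕ) * (1 + h) ^ m) * h := by
      calc _ = (s.card : ℝ) * h ^ (m + 1) := by ring
        _ ≤ _ := hle2.trans hbern
        _ = _ := by ring
    exact le_of_mul_le_mul_right this h0
  have h3 : (1 + h) / h ≤ 3 / δ := by
    rw [div_le_div_iff₀ h0 hδ]; rw [hh]; nlinarith
  calc (s.card : ℝ) ≤ 2 * (m + 1 : ℕ) * (1 + h) ^ m / h ^ m := by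
        rwa [le_div_iff₀ (by positivity)]
    _ = 2 * (m + 1 : ℕ) * ((1 + h) / h) ^ m := by
        rw [div_pow (1 + h), mul_div_assoc]
    _ ≤ 2 * (m + 1 : ℕ) * (3 / δ) ^ m := by gcongr
    _ = _ := by simp

/-- A family of points of the unit ball of `ℝ^d` has a subset of at most `2d(3/δ)^(d-1)` points
whose support function is within `δ²` of that of the family. -/
theorem exists_small_support_net {d n : ℕ} (hd : 0 < d) (hn : 0 < n)
    (v : Fin n → EuclideanSpace ℝ (Fin d)) (hv : ∀ i, ‖v i‖ ≤ 1) {δ : ℝ} (hδ : 0 < δ)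
    (hδ1 : δ ≤ 1) :
    ∃ s : Finset (EuclideanSpace ℝ (Fin d)), (∀ z ∈ s, z ∈ Set.range v) ∧
      (s.card : ℝ) ≤ 2 * d * (3 / δ) ^ (d - 1) ∧
      ∀ S : EuclideanSpace ℝ (Fin d), ∃ z ∈ s, ∀ i,
        inner ℝ (v i) S ≤ inner ℝ z S + δ ^ 2 * ‖S‖ := by
  classical
  have : Nonempty (Fin n) := ⟨⟨0, hn⟩⟩
  have hmax : ∀ u : EuclideanSpace ℝ (Fin d), ∃ i, ∀ j, inner ℝ (v j) u ≤ inner ℝ (v i) u :=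
    fun u => Finite.exists_max fun i => inner ℝ (v i) u
  choose x hx using hmax
  -- A maximizing vertex is pushed along its direction `u` until it meets the sphere of radius `2`:
  -- the norm is at most `2` for `l = 1` and at least `2` for `l = 3`. That `l ≥ 1` is used in
  -- `hgap`.
  have hlam : ∀ u : EuclideanSpace ℝ (Fin d), ∃ l : ℝ, 1 ≤ l ∧
      (‖u‖ = 1 → ‖v (x u) + l • u‖ = 2) := by
    intro u
    by_cases hu : ‖u‖ = 1
    · have hc : ContinuousOn (fun l : ℝ => ‖v (x u) + l • u‖) (Set.Icc 1 3) := by fun_prop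
      have h := intermediate_value_Icc (by norm_num : (1 : ℝ) ≤ 3) hc
      have h1 : ‖v (x u) + (1 : ℝ) • u‖ ≤ 2 := by
        refine (norm_add_le _ _).trans ?_
        rw [one_smul, hu]; linarith [hv (x u)]
      have h3 : 2 ≤ ‖v (x u) + (3 : ℝ) • u‖ := by
        have := norm_sub_le (v (x u) + (3 : ℝ) • u) (v (x u))
        rw [add_sub_cancel_left, norm_smul, hu] at this
        have := hv (x u)
        norm_num at *
        linarith
      obtain ⟨l, hl, hl2⟩ := h ⟨h1, h3⟩
      exact ⟨l, hl.1, fun _ => hl2⟩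
    · exact ⟨1, le_rfl, fun h => absurd h hu⟩
  choose l hl1 hl2 using hlam
  set g : EuclideanSpace ℝ (Fin d) → EuclideanSpace ℝ (Fin d) :=
    fun u => v (x u) + l u • u with hg
  -- The quadratic gain: maximality of both vertices gives `⟨a, u⟩ ≤ ⟨a, b⟩`, and `4⟨a, b⟩ = ‖a +
  -- b‖² - ‖a - b‖²`.
  have hgap : ∀ u u', inner ℝ (v (x u)) u ≤ inner ℝ (v (x u')) u + ‖g u - g u'‖ ^ 2 / 4 := by
    intro u u'
    set a := v (x u) - v (x u')
    set b := l u • u - l u' • u'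
    have hab : g u - g u' = a + b := by simp only [hg, a, b]; abel
    have hA : 0 ≤ inner ℝ a u := by
      simp only [a, inner_sub_left]; linarith [hx u (x u')]
    have hA' : inner ℝ a u' ≤ 0 := by
      simp only [a, inner_sub_left]; linarith [hx u' (x u)]
    have h2 : inner ℝ a u ≤ inner ℝ a b := by
      simp only [b, inner_sub_right, inner_smul_right]
      nlinarith [hl1 u, hl1 u']
    have h3 := norm_add_sq_real a b
    have h4 := norm_sub_sq_real a b
    have h5 : inner ℝ a u = inner ℝ (v (x u)) u - inner ℝ (v (x u')) u := by
      simp only [a, inner_sub_left]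
    rw [hab]
    nlinarith [sq_nonneg ‖a - b‖]
  -- The images `g u` are separated, not the directions, since `hgap` is in terms of the images.
  -- Halving them gives `δ`-separated points of the unit sphere.
  let Sep : Finset (EuclideanSpace ℝ (Fin d)) → Prop := fun s =>
    (∀ u ∈ s, ‖u‖ = 1) ∧ ∀ u ∈ s, ∀ u' ∈ s, u ≠ u' → 2 * δ ≤ ‖g u - g u'‖
  have hcard : ∀ s, Sep s → (s.card : ℝ) ≤ 2 * d * (3 / δ) ^ (d - 1) := by
    intro s ⟨hs1, hs2⟩
    have hd2 : ∀ u u', dist ((1 / 2 : ℝ) • g u) ((1 / 2 : ℝ) • g u') = 1 / 2 * ‖g u - g u'‖ := by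
      intro u u'
      rw [dist_eq_norm, ← smul_sub, norm_smul]; norm_num
    have hinj : Set.InjOn (fun u => (1 / 2 : ℝ) • g u) s := by
      intro u hu u' hu' he
      by_contra hne
      have h1 := hs2 u hu u' hu' hne
      have h2 := hd2 u u'
      simp only at he
      rw [he, dist_self] at h2
      linarith
    rw [← Finset.card_image_of_injOn hinj]
    refine card_le_of_separated_sphere hd hδ hδ1 _ ?_ ?_
    · intro y hy
      obtain ⟨u, hu, rfl⟩ := Finset.mem_image.1 hy
      rw [norm_smul, hl2 u (hs1 u hu)]; norm_num
    · intro y hy y' hy' hne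
      obtain ⟨u, hu, rfl⟩ := Finset.mem_image.1 hy
      obtain ⟨u', hu', rfl⟩ := Finset.mem_image.1 hy'
      have := hs2 u hu u' hu' (fun h => hne (by rw [h]))
      rw [hd2]; linarith
  -- The packing bound provides a separated set of greatest cardinality; being maximal, it is a net.
  obtain ⟨s, hsS, hsmax⟩ : ∃ s, Sep s ∧ ∀ s', Sep s' → s'.card ≤ s.card := by
    have hbdd : BddAbove {m | ∃ s, Sep s ∧ s.card = m} := by
      refine ⟨⌊2 * d * (3 / δ) ^ (d - 1)⌋₊, ?_⟩
      rintro m ⟨s, hs, rfl⟩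
      exact Nat.le_floor (hcard s hs)
    have hne : {m | ∃ s, Sep s ∧ s.card = m}.Nonempty :=
      ⟨0, ∅, ⟨by simp, by simp⟩, rfl⟩
    obtain ⟨s, hs, he⟩ := Nat.sSup_mem hne hbdd
    exact ⟨s, hs, fun s' hs' => he ▸ le_csSup hbdd ⟨s', hs', rfl⟩⟩
  have hcover : ∀ u, ‖u‖ = 1 → ∃ u' ∈ s, ‖g u - g u'‖ ≤ 2 * δ := by
    intro u hu
    by_contra! hcon
    have hnot : u ∉ s := fun h => by
      have := hcon u h
      rw [sub_self, norm_zero] at this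
      linarith
    have hS' : Sep (insert u s) := by
      refine ⟨?_, ?_⟩
      · intro w hw
        rcases Finset.mem_insert.1 hw with rfl | hw
        · exact hu
        · exact hsS.1 w hw
      · intro w hw w' hw' hne
        rcases Finset.mem_insert.1 hw with rfl | hw1 <;>
          rcases Finset.mem_insert.1 hw' with rfl | hw2
        · exact absurd rfl hne
        · exact (hcon w' hw2).le
        · rw [norm_sub_rev]; exact (hcon w hw1).le
        · exact hsS.2 w hw1 w' hw2 hne
    have := hsmax _ hS'
    rw [Finset.card_insert_of_notMem hnot] at this
    omega
  have hunit : ∀ u, ‖u‖ = 1 → ∃ z ∈ s.image fun u => v (x u), ∀ i,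
      inner ℝ (v i) u ≤ inner ℝ z u + δ ^ 2 := by
    intro u hu
    obtain ⟨u', hu', hle⟩ := hcover u hu
    refine ⟨v (x u'), Finset.mem_image_of_mem _ hu', fun i => ?_⟩
    have h1 := hx u i
    have h2 := hgap u u'
    have h3 : ‖g u - g u'‖ ^ 2 ≤ (2 * δ) ^ 2 := by gcongr
    linarith
  refine ⟨s.image fun u => v (x u), ?_, ?_, ?_⟩
  · intro z hz
    obtain ⟨u, _, rfl⟩ := Finset.mem_image.1 hz
    exact ⟨_, rfl⟩
  · refine le_trans ?_ (hcard s hsS)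
    exact_mod_cast Finset.card_image_le
  · intro S
    by_cases hS : S = 0
    · subst hS
      -- For `S = 0` only nonemptiness of the net is needed; any unit vector shows it, and one
      -- exists because `d > 0`.
      obtain ⟨z, hz, _⟩ := hunit (EuclideanSpace.single ⟨0, hd⟩ 1) (by simp)
      exact ⟨z, hz, by simp⟩
    · have hS0 : 0 < ‖S‖ := norm_pos_iff.2 hS
      obtain ⟨z, hz, h⟩ := hunit (‖S‖⁻¹ • S) (by
        rw [norm_smul, norm_inv, norm_norm, inv_mul_cancel₀ hS0.ne'])
      refine ⟨z, hz, fun i => ?_⟩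
      have := h i
      rw [inner_smul_right, inner_smul_right] at this
      have h2 := mul_le_mul_of_nonneg_left this hS0.le
      rw [mul_add, ← mul_assoc, ← mul_assoc, mul_inv_cancel₀ hS0.ne', one_mul, one_mul] at h2
      linarith

/-! ### Multiplicative weights and swap regret -/

/-- The regret of multiplicative weights with the update factors `1 + a_t g_t(j)`. -/
theorem multiplicative_weights_regret {N : ℕ} (hN : 0 < N) (a : ℕ → ℝ) (g w : ℕ → ℕ → ℝ) (T : ℕ)
    (ha0 : ∀ t < T, 0 ≤ a t) (ha : ∀ t < T, a t ≤ 1 / 2) (hg : ∀ t < T, ∀ j < N, |g t j| ≤ 1)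
    (hw0 : ∀ j < N, w 0 j = 1)
    (hw : ∀ t < T, ∀ j < N, w (t + 1) j = w t j * (1 + a t * g t j)) (j : ℕ) (hj : j < N) :
    ∑ t ∈ Finset.range T, a t * (g t j -
        (∑ i ∈ Finset.range N, w t i * g t i) / ∑ i ∈ Finset.range N, w t i) ≤
      Real.log N + 2 * ∑ t ∈ Finset.range T, a t ^ 2 := by
  have hx : ∀ t < T, ∀ i < N, -(1 / 2) ≤ a t * g t i ∧ a t * g t i ≤ 1 / 2 := by
    intro t ht i hi
    have h1 : |a t * g t i| ≤ 1 / 2 := by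
      rw [abs_mul, abs_of_nonneg (ha0 t ht)]
      calc a t * |g t i| ≤ a t * 1 := by gcongr; exacts [ha0 t ht, hg t ht i hi]
        _ ≤ 1 / 2 := by linarith [ha t ht]
    exact abs_le.1 h1
  have hpos : ∀ t ≤ T, ∀ i < N, 0 < w t i := by
    intro t
    induction t with
    | zero => intro _ i hi; rw [hw0 i hi]; norm_num
    | succ t ih =>
      intro ht i hi
      rw [hw t (by omega) i hi]
      have := hx t (by omega) i hi
      exact mul_pos (ih (by omega) i hi) (by linarith)
  have hW : ∀ t ≤ T, 0 < ∑ i ∈ Finset.range N, w t i := fun t ht =>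
    Finset.sum_pos (fun i hi => hpos t ht i (Finset.mem_range.1 hi)) ⟨0, Finset.mem_range.2 hN⟩
  -- Lower bound for the potential: `log (1 + x) ≥ x - 2x²` for `x ≥ -1/2`, which follows from `log
  -- y ≥ 1 - 1/y`.
  have hlow : ∀ t ≤ T, ∑ s ∈ Finset.range t, (a s * g s j - 2 * a s ^ 2) ≤ Real.log (w t j) := by
    intro t
    induction t with
    | zero => intro _; simp [hw0 j hj]
    | succ t ih =>
      intro ht
      have hxt := hx t (by omega) j hj
      have h0 : 0 < 1 + a t * g t j := by linarith
      rw [Finset.sum_range_succ, hw t (by omega) j hj,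
        Real.log_mul (hpos t (by omega) j hj).ne' h0.ne']
      have h1 := Real.one_sub_inv_le_log_of_pos h0
      have hsq : (a t * g t j) ^ 2 ≤ a t ^ 2 := by
        rw [mul_pow]
        have : g t j ^ 2 ≤ 1 := by
          rw [sq_le_one_iff_abs_le_one]; exact hg t (by omega) j hj
        nlinarith [sq_nonneg (a t)]
      have h2 : a t * g t j - 2 * (a t * g t j) ^ 2 ≤ 1 - (1 + a t * g t j)⁻¹ := by
        set x := a t * g t j
        have : 1 - (1 + x)⁻¹ - (x - 2 * x ^ 2) = x ^ 2 * (1 + 2 * x) / (1 + x) := by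
          field_simp; ring
        have h3 : 0 ≤ x ^ 2 * (1 + 2 * x) / (1 + x) :=
          div_nonneg (mul_nonneg (sq_nonneg x) (by linarith)) h0.le
        linarith
      have := ih (by omega)
      linarith
  -- Upper bound for the potential: the total weight grows by one plus the mean gain times the rate,
  -- and `log y ≤ y - 1`.
  have hup : ∀ t ≤ T, Real.log (∑ i ∈ Finset.range N, w t i) ≤ Real.log N +
      ∑ s ∈ Finset.range t, a s *
        ((∑ i ∈ Finset.range N, w s i * g s i) / ∑ i ∈ Finset.range N, w s i) := by
    intro t
    induction t with
    | zero =>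
      intro _
      rw [Finset.sum_congr rfl fun i hi => hw0 i (Finset.mem_range.1 hi)]
      simp
    | succ t ih =>
      intro ht
      have hWt := hW t (by omega)
      have hWt1 := hW (t + 1) ht
      have he : ∑ i ∈ Finset.range N, w (t + 1) i = (∑ i ∈ Finset.range N, w t i) *
          (1 + a t * ((∑ i ∈ Finset.range N, w t i * g t i) / ∑ i ∈ Finset.range N, w t i)) := by
        rw [Finset.sum_congr rfl fun i hi => hw t (by omega) i (Finset.mem_range.1 hi)]
        field_simp
        rw [Finset.mul_sum, ← Finset.sum_add_distrib]
        exact Finset.sum_congr rfl fun i _ => by ring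
      rw [he] at hWt1
      have hf := pos_of_mul_pos_right hWt1 hWt.le
      rw [he, Real.log_mul hWt.ne' hf.ne', Finset.sum_range_succ]
      have h1 := Real.log_le_sub_one_of_pos hf
      have := ih (by omega)
      linarith
  have hmid : Real.log (w T j) ≤ Real.log (∑ i ∈ Finset.range N, w T i) :=
    Real.log_le_log (hpos T le_rfl j hj) (Finset.single_le_sum
      (f := fun i => w T i) (fun i hi => (hpos T le_rfl i (Finset.mem_range.1 hi)).le)
      (Finset.mem_range.2 hj))
  have h1 := hlow T le_rfl
  have h2 := hup T le_rfl
  rw [Finset.sum_sub_distrib, ← Finset.mul_sum] at h1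
  simp only [mul_sub, Finset.sum_sub_distrib]
  linarith

/-- Swap regret of the reduction to one copy of multiplicative weights per action, when the played
distribution `μ_t` is nearly stationary for the matrix of the normalized weights. -/
theorem swap_regret_of_nearly_stationary {N : ℕ} (hN : 0 < N) {η τ : ℝ} (hη : 0 < η)
    (hη2 : η ≤ 1 / 2) (T : ℕ) (μ g : ℕ → ℕ → ℝ) (w : ℕ → ℕ → ℕ → ℝ)
    (hμ0 : ∀ t < T, ∀ i < N, 0 ≤ μ t i) (hμ1 : ∀ t < T, ∑ i ∈ Finset.range N, μ t i = 1)
    (hg : ∀ t < T, ∀ j < N, |g t j| ≤ 1)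
    (hw0 : ∀ i < N, ∀ j < N, w 0 i j = 1)
    (hw : ∀ t < T, ∀ i < N, ∀ j < N, w (t + 1) i j = w t i j * (1 + η * μ t i * g t j))
    (hst : ∀ t < T, ∑ i ∈ Finset.range N, μ t i *
        ((∑ j ∈ Finset.range N, w t i j * g t j) / ∑ j ∈ Finset.range N, w t i j) ≤
      ∑ i ∈ Finset.range N, μ t i * g t i + τ)
    (f : ℕ → ℕ) (hf : ∀ i < N, f i < N) :
    ∑ i ∈ Finset.range N, ∑ t ∈ Finset.range T, μ t i * (g t (f i) - g t i) ≤
      N * Real.log N / η + 2 * η * T + T * τ := by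
  have hμle : ∀ t < T, ∀ i < N, μ t i ≤ 1 := by
    intro t ht i hi
    rw [← hμ1 t ht]
    exact Finset.single_le_sum (f := fun i => μ t i)
      (fun i hi => hμ0 t ht i (Finset.mem_range.1 hi)) (Finset.mem_range.2 hi)
  set avg : ℕ → ℕ → ℝ := fun t i =>
    (∑ j ∈ Finset.range N, w t i j * g t j) / ∑ j ∈ Finset.range N, w t i j with havg
  have h1 : ∀ i < N, ∑ t ∈ Finset.range T, μ t i * (g t (f i) - avg t i) ≤
      Real.log N / η + 2 * η * ∑ t ∈ Finset.range T, μ t i := by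
    intro i hi
    -- Copy `i` has the step sizes `η μ_t(i)`. As `μ_t(i) ≤ 1`, its second-order terms are at most
    -- `η² ∑_t μ_t(i)`, so that together the copies pay `η² T` and not `N η² T`.
    have h := multiplicative_weights_regret hN (fun t => η * μ t i) g (fun t j => w t i j) T
      (fun t ht => mul_nonneg hη.le (hμ0 t ht i hi))
      (fun t ht => by nlinarith [hμle t ht i hi, hμ0 t ht i hi]) hg (hw0 i hi)
      (fun t ht j hj => hw t ht i hi j hj) (f i) (hf i hi)
    have h2 : ∑ t ∈ Finset.range T, (η * μ t i) ^ 2 ≤ η ^ 2 * ∑ t ∈ Finset.range T, μ t i := by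
      rw [Finset.mul_sum]
      refine Finset.sum_le_sum fun t ht => ?_
      have ht := Finset.mem_range.1 ht
      rw [mul_pow]
      gcongr
      nlinarith [hμle t ht i hi, hμ0 t ht i hi]
    have h3 : η * ∑ t ∈ Finset.range T, μ t i * (g t (f i) - avg t i) ≤
        Real.log N + 2 * (η ^ 2 * ∑ t ∈ Finset.range T, μ t i) := by
      rw [Finset.mul_sum]
      simp only [← mul_assoc]
      beta_reduce at h
      linarith
    have h4 : Real.log N / η + 2 * η * ∑ t ∈ Finset.range T, μ t i =
        (Real.log N + 2 * (η ^ 2 * ∑ t ∈ Finset.range T, μ t i)) / η := by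
      field_simp
    rw [h4, le_div_iff₀ hη]
    linarith
  have h2 : ∑ i ∈ Finset.range N, ∑ t ∈ Finset.range T, μ t i * (g t (f i) - avg t i) ≤
      N * Real.log N / η + 2 * η * T := by
    calc _ ≤ ∑ i ∈ Finset.range N, (Real.log N / η + 2 * η * ∑ t ∈ Finset.range T, μ t i) :=
          Finset.sum_le_sum fun i hi => h1 i (Finset.mem_range.1 hi)
      _ = N * Real.log N / η + 2 * η * ∑ t ∈ Finset.range T, ∑ i ∈ Finset.range N, μ t i := by
          rw [Finset.sum_add_distrib, ← Finset.mul_sum, Finset.sum_comm]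
          simp [mul_div_assoc]
      _ = _ := by
          rw [Finset.sum_congr rfl fun t ht => hμ1 t (Finset.mem_range.1 ht)]
          simp
  -- The only use of near stationarity: replacing the played points by the copies' recommendations
  -- costs `τ` per round.
  have h3 : ∑ i ∈ Finset.range N, ∑ t ∈ Finset.range T, μ t i * (avg t i - g t i) ≤ T * τ := by
    rw [Finset.sum_comm]
    calc _ ≤ ∑ t ∈ Finset.range T, τ := by
          refine Finset.sum_le_sum fun t ht => ?_
          have := hst t (Finset.mem_range.1 ht)
          simp only [mul_sub, Finset.sum_sub_distrib]
          linarith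
      _ = _ := by simp
  have h4 : ∑ i ∈ Finset.range N, ∑ t ∈ Finset.range T, μ t i * (g t (f i) - g t i) =
      ∑ i ∈ Finset.range N, ∑ t ∈ Finset.range T, μ t i * (g t (f i) - avg t i) +
      ∑ i ∈ Finset.range N, ∑ t ∈ Finset.range T, μ t i * (avg t i - g t i) := by
    rw [← Finset.sum_add_distrib]
    refine Finset.sum_congr rfl fun i _ => ?_
    rw [← Finset.sum_add_distrib]
    exact Finset.sum_congr rfl fun t _ => by ring
  linarith

/-! ### Reasoning about real-RAM programs -/

namespace RealRAM

namespace Store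

@[simp] theorem setNat_real (s : Store) (a i j k : ℕ) : (s.setNat a i j k).real = s.real := rfl

@[simp] theorem setNat_out (s : Store) (a i j k : ℕ) : (s.setNat a i j k).out = s.out := rfl

@[simp] theorem setReal_nat (s : Store) (a i j : ℕ) (x : ℝ) : (s.setReal a i j x).nat = s.nat := rfl

theorem setNat_nat_ne (s : Store) {a b : ℕ} (h : b ≠ a) (i j k : ℕ) :
    (s.setNat a i j k).nat b = s.nat b := by
  funext i' j'; simp [setNat, h]

@[simp] theorem setNat_nat_same (s : Store) (a i j k : ℕ) : (s.setNat a i j k).nat a i j = k := by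
  simp [setNat]

theorem setReal_real_ne (s : Store) {a b : ℕ} (h : b ≠ a) (i j : ℕ) (x : ℝ) :
    (s.setReal a i j x).real b = s.real b := by
  funext i' j'; simp [setReal, h]

@[simp] theorem setReal_real_same (s : Store) (a i j : ℕ) (x : ℝ) :
    (s.setReal a i j x).real a i j = x := by
  simp [setReal]

theorem setReal_real_of_ne (s : Store) (a : ℕ) {i j i' j' : ℕ} (x : ℝ) (h : i' ≠ i ∨ j' ≠ j) :
    (s.setReal a i j x).real a i' j' = s.real a i' j' := by
  simp only [setReal]
  rw [if_neg]
  rintro ⟨_, rfl, rfl⟩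
  simp at h

end Store

/-- The stores `s` and `s'` agree except for the natural-number arrays in `X` and the real arrays
in `A`. -/
structure Frame (X A : List ℕ) (s s' : Store) : Prop where
  nat : ∀ a ∉ X, s'.nat a = s.nat a
  real : ∀ a ∉ A, s'.real a = s.real a
  out : s'.out = s.out

namespace Frame

variable {X A X' A' : List ℕ} {s s' s'' : Store}

theorem refl (X A : List ℕ) (s : Store) : Frame X A s s := ⟨fun _ _ => rfl, fun _ _ => rfl, rfl⟩

theorem trans (h : Frame X A s s') (h' : Frame X A s' s'') : Frame X A s s'' :=
  ⟨fun a ha => (h'.nat a ha).trans (h.nat a ha), fun a ha => (h'.real a ha).trans (h.real a ha),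
    h'.out.trans h.out⟩

theorem mono (h : Frame X A s s') (hX : X ⊆ X') (hA : A ⊆ A') : Frame X' A' s s' :=
  ⟨fun a ha => h.nat a fun h => ha (hX h), fun a ha => h.real a fun h => ha (hA h), h.out⟩

theorem setNat (h : Frame X A s s') {x : ℕ} (hx : x ∈ X) (i j k : ℕ) :
    Frame X A s (s'.setNat x i j k) :=
  ⟨fun a ha => (Store.setNat_nat_ne s' (by rintro rfl; exact ha hx) i j k).trans (h.nat a ha),
    h.real, h.out⟩

theorem setReal (h : Frame X A s s') {a : ℕ} (ha : a ∈ A) (i j : ℕ) (x : ℝ) :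
    Frame X A s (s'.setReal a i j x) :=
  ⟨h.nat, fun b hb => (Store.setReal_real_ne s' (by rintro rfl; exact hb ha) i j x).trans
    (h.real b hb),
    h.out⟩

end Frame

theorem NExp.eval_congr {s s' : Store} (h : s'.nat = s.nat) (e : NExp) : e.eval s' = e.eval s := by
  induction e with
  | const k => rfl
  | get a i j hi hj => simp only [NExp.eval, hi, hj, h]
  | add e f he hf => simp only [NExp.eval, he, hf]
  | sub e f he hf => simp only [NExp.eval, he, hf]

/-- The natural-number variable in the cell `(x, 0, 0)`. -/
def NExp.var (x : ℕ) : NExp := .get x (.const 0) (.const 0)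

@[simp] theorem NExp.eval_var (x : ℕ) (s : Store) : (NExp.var x).eval s = s.nat x 0 0 := rfl

variable {d : ℕ} (Q : EuclideanSpace ℝ (Fin d) → List (ℕ × ℝ) × ℕ)

/-- Run from `s`, the program `c` ends in a store with property `R` after at most `B` steps. -/
def Spec (c : Cmd) (s : Store) (R : Store → Prop) (B : ℕ) : Prop :=
  R (c.run Q s).1 ∧ (c.run Q s).2 ≤ B

variable {Q}

theorem Spec.imp {c : Cmd} {s : Store} {R R' : Store → Prop} {B : ℕ} (h : Spec Q c s R B)
    (hR : ∀ s', R s' → R' s') : Spec Q c s R' B :=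
  ⟨hR _ h.1, h.2⟩

theorem Spec.mono {c : Cmd} {s : Store} {R : Store → Prop} {B B' : ℕ} (h : Spec Q c s R B)
    (hB : B ≤ B') : Spec Q c s R B' :=
  ⟨h.1, h.2.trans hB⟩

/-- The rule for counted loops, with an invariant and a bound for the cost of an iteration. -/
theorem Spec.loop {x n B : ℕ} {e : NExp} {c : Cmd} {s : Store} (Inv : ℕ → Store → Prop)
    (hn : e.eval s = n) (h0 : Inv 0 s)
    (hstep : ∀ k < n, ∀ s', Inv k s' → Spec Q c (s'.setNat x 0 0 k) (Inv (k + 1)) B) :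
    Spec Q (Cmd.loop x e c) s (Inv n) (e.cost + 1 + n * (B + 1)) := by
  simp only [Spec, Cmd.run, hn]
  have key : ∀ m ≤ n, Inv m ((List.range m).foldl (fun acc k =>
        ((c.run Q (acc.1.setNat x 0 0 k)).1, acc.2 + (c.run Q (acc.1.setNat x 0 0 k)).2 + 1))
        (s, e.cost + 1)).1 ∧ ((List.range m).foldl (fun acc k =>
        ((c.run Q (acc.1.setNat x 0 0 k)).1, acc.2 + (c.run Q (acc.1.setNat x 0 0 k)).2 + 1))
        (s, e.cost + 1)).2 ≤ e.cost + 1 + m * (B + 1) := by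
    intro m
    induction m with
    | zero => intro _; simpa using h0
    | succ m ih =>
      intro hm
      obtain ⟨h1, h2⟩ := ih (by omega)
      rw [List.range_succ, List.foldl_append]
      simp only [List.foldl_cons, List.foldl_nil]
      obtain ⟨h3, h4⟩ := hstep m (by omega) _ h1
      refine ⟨h3, ?_⟩
      have : (m + 1) * (B + 1) = m * (B + 1) + (B + 1) := by ring
      omega
  exact key n le_rfl

/-- The rule for sequencing. -/
theorem Spec.seq {c₁ c₂ : Cmd} {s : Store} {P R : Store → Prop} {B₁ B₂ : ℕ}
    (h₁ : Spec Q c₁ s P B₁) (h₂ : ∀ s', P s' → Spec Q c₂ s' R B₂) :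
    Spec Q (Cmd.seq c₁ c₂) s R (B₁ + B₂) := by
  obtain ⟨h3, h4⟩ := h₂ _ h₁.1
  exact ⟨h3, Nat.add_le_add h₁.2 h4⟩

/-- The rule for conditionals. -/
theorem Spec.ite {t : Test} {c₁ c₂ : Cmd} {s : Store} {R : Store → Prop} {B : ℕ}
    (h₁ : t.holds s → Spec Q c₁ s R B) (h₂ : ¬ t.holds s → Spec Q c₂ s R B) :
    Spec Q (Cmd.ite t c₁ c₂) s R (t.cost + B) := by
  by_cases h : t.holds s
  · simp only [Spec, Cmd.run, if_pos h]
    exact ⟨(h₁ h).1, Nat.add_le_add_left (h₁ h).2 _⟩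
  · simp only [Spec, Cmd.run, if_neg h]
    exact ⟨(h₂ h).1, Nat.add_le_add_left (h₂ h).2 _⟩

theorem Spec.setReal {a : ℕ} {i j : NExp} {e : RExp} {s : Store} {R : Store → Prop}
    (h : R (s.setReal a (i.eval s) (j.eval s) (e.eval s))) :
    Spec Q (Cmd.setReal a i j e) s R (i.cost + j.cost + e.cost + 1) :=
  ⟨h, le_rfl⟩

theorem Spec.setNat {a : ℕ} {i j : NExp} {e : NExp} {s : Store} {R : Store → Prop}
    (h : R (s.setNat a (i.eval s) (j.eval s) (e.eval s))) :
    Spec Q (Cmd.setNat a i j e) s R (i.cost + j.cost + e.cost + 1) :=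
  ⟨h, le_rfl⟩

/-! ### Program templates for sums and entrywise maps. -/

/-- `real (10, 0, 0) := ∑ x < n, e`. -/
def sumCmd (x : ℕ) (n : NExp) (e : RExp) : Cmd :=
  .seq (.setReal 10 (.const 0) (.const 0) (.ofNat (.const 0)))
    (.loop x n (.setReal 10 (.const 0) (.const 0) (.add e (.get 10 (.const 0) (.const 0)))))

theorem spec_sumCmd {x n₀ : ℕ} {n : NExp} {e : RExp} {s : Store} {f : ℕ → ℝ}
    (hn : n.eval s = n₀)
    (he : ∀ s' l, Frame [x] [10] s s' → l < n₀ → s'.nat x 0 0 = l → e.eval s' = f l) :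
    Spec Q (sumCmd x n e) s (fun s₁ => Frame [x] [10] s s₁ ∧
      s₁.real 10 0 0 = ∑ l ∈ Finset.range n₀, f l) (5 + (n.cost + 1 + n₀ * (e.cost + 8))) := by
  refine Spec.seq (P := fun s' => Frame [x] [10] s s' ∧ s'.real 10 0 0 = 0 ∧ n.eval s' = n₀)
    (Spec.setReal ⟨(Frame.refl _ _ s).setReal (by simp) _ _ _, ?_, ?_⟩) ?_
  · simp [NExp.eval, RExp.eval]
  · rw [← hn]; exact NExp.eval_congr (Store.setReal_nat ..) n
  · rintro s₁ ⟨hF, h0, hn₁⟩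
    refine Spec.loop (fun m s' => Frame [x] [10] s s' ∧
      s'.real 10 0 0 = ∑ l ∈ Finset.range m, f l) hn₁ ⟨hF, by simpa using h0⟩ ?_
    rintro k hk s' ⟨hF', hs'⟩
    have hF₂ := hF'.setNat (x := x) (by simp) 0 0 k
    refine ⟨⟨hF₂.setReal (by simp) _ _ _, ?_⟩, ?_⟩
    · simp [Cmd.run, NExp.eval, RExp.eval, hs', he _ k hF₂ hk (by simp), Finset.sum_range_succ,
        add_comm]
    · simp only [Cmd.run, NExp.cost, RExp.cost]; omega

/-- `for i < N: real (a, i, 0) := ∑ l < n, e`, with `i`, `l` in the variables `1`, `2`. -/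
def vecSumCmd (a : ℕ) (N n : NExp) (e : RExp) : Cmd :=
  .loop 1 N (.seq (sumCmd 2 n e)
    (.setReal a (.var 1) (.const 0) (.get 10 (.const 0) (.const 0))))

theorem spec_vecSumCmd {a n₀ N₀ : ℕ} {N n : NExp} {e : RExp} {s : Store} {f : ℕ → ℕ → ℝ}
    (ha : a ≠ 10) (hN : N.eval s = N₀) (hn : ∀ s', Frame [1, 2] [10, a] s s' → n.eval s' = n₀)
    (he : ∀ s' i l, Frame [1, 2] [10, a] s s' → i < N₀ → l < n₀ → s'.nat 1 0 0 = i →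
      s'.nat 2 0 0 = l → e.eval s' = f i l) :
    Spec Q (vecSumCmd a N n e) s (fun s₁ => Frame [1, 2] [10, a] s s₁ ∧
      ∀ i < N₀, s₁.real a i 0 = ∑ l ∈ Finset.range n₀, f i l)
      (N.cost + 1 + N₀ * (5 + (n.cost + 1 + n₀ * (e.cost + 8)) + 8 + 1)) := by
  refine Spec.loop (fun m s' => Frame [1, 2] [10, a] s s' ∧
      ∀ i < m, s'.real a i 0 = ∑ l ∈ Finset.range n₀, f i l) hN ⟨Frame.refl _ _ _, by simp⟩ ?_
  rintro k hk s' ⟨hF, hs'⟩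
  have hF₁ := hF.setNat (x := 1) (by simp) 0 0 k
  refine Spec.seq (spec_sumCmd (f := f k) (hn _ hF₁) (fun s₂ l h2 hl hl2 => he s₂ k l
        (hF₁.trans (h2.mono (by simp) (by simp))) hk hl
        (by rw [h2.nat 1 (by simp)]; simp) hl2)) ?_
  rintro s₂ ⟨hF₂, hsum⟩
  have hF₃ := hF₁.trans (hF₂.mono (X' := [1, 2]) (A' := [10, a]) (by simp) (by simp))
  have hk₂ : s₂.nat 1 0 0 = k := by rw [hF₂.nat 1 (by simp)]; simp
  have hr : s₂.real a = s'.real a := by rw [hF₂.real a (by simpa using ha)]; simp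
  refine ⟨⟨hF₃.setReal (by simp) _ _ _, ?_⟩, ?_⟩
  · intro i hi
    simp only [Cmd.run, NExp.eval, RExp.eval, NExp.eval_var, hk₂, hsum]
    rcases Nat.lt_succ_iff_lt_or_eq.1 hi with hi | rfl
    · rw [Store.setReal_real_of_ne _ _ _ (Or.inl hi.ne), hr, hs' i hi]
    · simp
  · simp [Cmd.run, NExp.cost, RExp.cost, NExp.var]

/-- `for i < N: real (a, i, 0) := e`, with `i` in the variable `1`. -/
def vecMapCmd (a : ℕ) (N : NExp) (e : RExp) : Cmd :=
  .loop 1 N (.setReal a (.var 1) (.const 0) e)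

/-- The expression may read the cell that is about to be overwritten, as the accumulation in
`walkStepCmd` does; the invariant therefore keeps track of the cells not yet reached. -/
theorem spec_vecMapCmd {a N₀ : ℕ} {N : NExp} {e : RExp} {s : Store} {f : ℕ → ℝ}
    (hN : N.eval s = N₀)
    (he : ∀ s' i, Frame [1] [a] s s' → i < N₀ → s'.nat 1 0 0 = i →
      s'.real a i 0 = s.real a i 0 → e.eval s' = f i) :
    Spec Q (vecMapCmd a N e) s (fun s₁ => Frame [1] [a] s s₁ ∧
      ∀ i < N₀, s₁.real a i 0 = f i) (N.cost + 1 + N₀ * (e.cost + 5 + 1)) := by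
  refine Spec.imp (Spec.loop (fun m s' => Frame [1] [a] s s' ∧ (∀ i < m, s'.real a i 0 = f i) ∧
      ∀ i ≥ m, s'.real a i 0 = s.real a i 0) hN ⟨Frame.refl _ _ _, by simp, by simp⟩ ?_)
    fun s' h => ⟨h.1, h.2.1⟩
  rintro k hk s' ⟨hF, hs', hs''⟩
  have hF₁ := hF.setNat (x := 1) (by simp) 0 0 k
  have hev := he _ k hF₁ hk (by simp) (hs'' k le_rfl)
  refine ⟨⟨hF₁.setReal (by simp) _ _ _, ?_, ?_⟩, ?_⟩
  · intro i hi
    simp only [Cmd.run, NExp.eval, NExp.eval_var, Store.setNat_nat_same, hev]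
    rcases Nat.lt_succ_iff_lt_or_eq.1 hi with hi | rfl
    · rw [Store.setReal_real_of_ne _ _ _ (Or.inl hi.ne)]; exact hs' i hi
    · simp
  · intro i hi
    simp only [Cmd.run, NExp.eval, NExp.eval_var, Store.setNat_nat_same, hev]
    rw [Store.setReal_real_of_ne _ _ _ (Or.inl (by omega))]
    exact hs'' i (by omega)
  · simp only [Cmd.run, NExp.cost, NExp.var]; omega

end RealRAM

/-! ### The learner's program -/

/-- The inverse learning rate: the least `k ≥ 2` with `T ≤ k² N`, by linear search. -/
def inverseRate (T N : ℕ) : ℕ := (fun k => if k * k * N < T then k + 1 else k)^[T] 2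

/-- The multiplicative weights update; the matrix `E` holds the weights minus one. -/
noncomputable def reweight (k : ℕ) (g : ℕ → ℝ) (E : ℕ → ℕ → ℝ) (μ : ℕ → ℝ) : ℕ → ℕ → ℝ :=
  fun i j => (1 + E i j) * (1 + μ i * g j / k) - 1

noncomputable def rowWeight (N : ℕ) (E : ℕ → ℕ → ℝ) (i : ℕ) : ℝ :=
  ∑ j ∈ Finset.range N, (1 + E i j)

/-- One step of the Markov chain given by the normalized weights. -/
noncomputable def transition (N : ℕ) (E : ℕ → ℕ → ℝ) (c : ℕ → ℝ) : ℕ → ℝ :=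
  fun j => ∑ i ∈ Finset.range N, c i * ((1 + E i j) / rowWeight N E i)

/-- The distribution after `m` steps of the Markov chain, from the uniform distribution. -/
noncomputable def walk (N : ℕ) (E : ℕ → ℕ → ℝ) (m : ℕ) : ℕ → ℝ :=
  (transition N E)^[m] fun _ => 1 / (N : ℝ)

/-- The average of the first `T` distributions of the Markov chain. -/
noncomputable def averagedWalk (T N : ℕ) (E : ℕ → ℕ → ℝ) : ℕ → ℝ :=
  fun j => (∑ m ∈ Finset.range T, walk N E m j) / T

namespace RealRAM

def dimExp : NExp := .get 0 (.const 0) (.const 0)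

def horizonExp : NExp := .get 0 (.const 0) (.const 1)

def sizeExp : NExp := .get 0 (.const 0) (.const 2)

/-- The comparison is made between reals because natural-number expressions have no product. -/
def rateCmd : Cmd :=
  .seq (.setNat 4 (.const 0) (.const 0) (.const 2))
    (.loop 1 horizonExp
      (.ite (.ltReal (.mul (.mul (.ofNat (.var 4)) (.ofNat (.var 4))) (.ofNat sizeExp))
          (.ofNat horizonExp))
        (.setNat 4 (.const 0) (.const 0) (.add (.var 4) (.const 1))) .skip))

def gainCmd : Cmd :=
  vecSumCmd 2 sizeExp dimExp (.mul (.get 0 (.var 1) (.var 2)) (.get 1 (.const 0) (.var 2)))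

def reweightCmd : Cmd :=
  .loop 1 sizeExp (.loop 2 sizeExp (.setReal 3 (.var 1) (.var 2)
    (.sub (.mul (.add (.ofNat (.const 1)) (.get 3 (.var 1) (.var 2)))
      (.add (.ofNat (.const 1)) (.div (.mul (.get 9 (.var 1) (.const 0))
        (.get 2 (.var 2) (.const 0))) (.ofNat (.var 4))))) (.ofNat (.const 1)))))

def rowWeightCmd : Cmd :=
  vecSumCmd 4 sizeExp sizeExp (.add (.ofNat (.const 1)) (.get 3 (.var 1) (.var 2)))

/-- Array `6` holds the current distribution and `7` the running sum, updated first so that `T`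
steps add up the times `0, …, T - 1`. The next distribution is built in array `8` because each of
its entries reads all of array `6`. -/
def walkStepCmd : Cmd :=
  .seq (vecMapCmd 7 sizeExp (.add (.get 7 (.var 1) (.const 0)) (.get 6 (.var 1) (.const 0))))
    (.seq (vecSumCmd 8 sizeExp sizeExp (.mul (.get 6 (.var 2) (.const 0))
        (.div (.add (.ofNat (.const 1)) (.get 3 (.var 2) (.var 1))) (.get 4 (.var 2) (.const 0)))))
      (vecMapCmd 6 sizeExp (.get 8 (.var 1) (.const 0))))

def averagedWalkCmd : Cmd :=
  .seq (vecMapCmd 6 sizeExp (.div (.ofNat (.const 1)) (.ofNat sizeExp)))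
    (.seq (vecMapCmd 7 sizeExp (.ofNat (.const 0)))
      (.seq (.loop 3 horizonExp walkStepCmd)
        (vecMapCmd 9 sizeExp (.div (.get 7 (.var 1) (.const 0)) (.ofNat horizonExp)))))

/-- Entries of an oracle's answer are stored from index `1`, as index `0` holds the length; hence
the shift of the inner counter. -/
def outputCmd : Cmd :=
  .loop 1 sizeExp (.seq (.query 0 (.var 1) 5)
    (.loop 2 (.var 5) (.emit (.get 5 (.add (.var 2) (.const 1)) (.const 0))
      (.mul (.get 9 (.var 1) (.const 0)) (.get 5 (.add (.var 2) (.const 1)) (.const 0))))))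

/-- The learner's program. -/
def learnerCmd : Cmd :=
  .seq rateCmd (.seq gainCmd (.seq reweightCmd (.seq rowWeightCmd
    (.seq averagedWalkCmd outputCmd))))

/-! ### Correctness and cost of the stages of the program. -/

variable {d : ℕ} {Q : EuclideanSpace ℝ (Fin d) → List (ℕ × ℝ) × ℕ} {T N : ℕ}

theorem spec_rateCmd {s : Store} (hT : s.nat 0 0 1 = T) (hN : s.nat 0 0 2 = N) :
    Spec Q rateCmd s (fun s₁ => Frame [1, 4] [] s s₁ ∧ s₁.nat 4 0 0 = inverseRate T N)
      (4 + (4 + T * 29)) := by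
  refine Spec.seq (Spec.setNat (R := fun s' => Frame [1, 4] [] s s' ∧ s'.nat 4 0 0 = 2)
    ⟨(Frame.refl _ _ s).setNat (by simp) _ _ _, by simp [NExp.eval]⟩) ?_
  rintro s₁ ⟨hF, h0⟩
  refine Spec.loop (B := 28) (fun m s' => Frame [1, 4] [] s s' ∧
      s'.nat 4 0 0 = (fun k => if k * k * N < T then k + 1 else k)^[m] 2)
    (by simp [horizonExp, NExp.eval, hF.nat 0 (by simp), hT]) ⟨hF, by simpa using h0⟩ ?_
  rintro k hk s' ⟨hF', hs'⟩
  have hF₂ := hF'.setNat (x := 1) (by simp) 0 0 k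
  have h4 : (s'.setNat 1 0 0 k).nat 4 0 0 =
      (fun k => if k * k * N < T then k + 1 else k)^[k] 2 := by
    rw [Store.setNat_nat_ne _ (by norm_num), hs']
  have hT' : (s'.setNat 1 0 0 k).nat 0 0 1 = T := by rw [hF₂.nat 0 (by simp), hT]
  have hN' : (s'.setNat 1 0 0 k).nat 0 0 2 = N := by rw [hF₂.nat 0 (by simp), hN]
  generalize (s'.setNat 1 0 0 k) = s₂ at *
  have hiff : (Test.ltReal (.mul (.mul (.ofNat (.var 4)) (.ofNat (.var 4))) (.ofNat sizeExp))
      (.ofNat horizonExp)).holds s₂ ↔ s₂.nat 4 0 0 * s₂.nat 4 0 0 * N < T := by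
    simp only [Test.holds, RExp.eval, NExp.eval_var, sizeExp, horizonExp, NExp.eval, hT', hN']
    norm_cast
  refine (Spec.ite (B := 8) ?_ ?_).mono ?_
  · intro h
    refine (Spec.setNat ⟨hF₂.setNat (by simp) _ _ _, ?_⟩)
    rw [hiff] at h
    rw [Function.iterate_succ_apply', ← h4, if_pos h]
    simp [NExp.eval]
  · intro h
    rw [hiff] at h
    refine ⟨⟨hF₂, ?_⟩, by simp [Cmd.run]⟩
    rw [Function.iterate_succ_apply', ← h4, if_neg h]
    rfl
  · decide

theorem spec_reweightCmd {s : Store} {k : ℕ} {g μ : ℕ → ℝ} {E : ℕ → ℕ → ℝ}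
    (hN : s.nat 0 0 2 = N) (hk : s.nat 4 0 0 = k) (hg : ∀ j < N, s.real 2 j 0 = g j)
    (hμ : ∀ i < N, s.real 9 i 0 = μ i) (hE : ∀ i < N, ∀ j < N, s.real 3 i j = E i j) :
    Spec Q reweightCmd s (fun s₁ => Frame [1, 2] [3] s s₁ ∧
      ∀ i < N, ∀ j < N, s₁.real 3 i j = reweight k g E μ i j) (4 + N * (4 + N * 42 + 1)) := by
  refine Spec.imp (Spec.loop (fun m s' => Frame [1, 2] [3] s s' ∧
      (∀ i < m, ∀ j < N, s'.real 3 i j = reweight k g E μ i j) ∧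
      ∀ i ≥ m, s'.real 3 i = s.real 3 i) hN ⟨Frame.refl _ _ _, by simp, by simp⟩ ?_)
    fun s' h => ⟨h.1, h.2.1⟩
  rintro m hm s' ⟨hF, hs', hs''⟩
  have hF₁ := hF.setNat (x := 1) (by simp) 0 0 m
  -- The update is in place, so the invariant records that in row `m` the columns from `l` on still
  -- hold the old weights.
  refine Spec.imp (Spec.loop (B := 41) (n := N) (fun l s₂ => Frame [1, 2] [3] s s₂ ∧
      s₂.nat 1 0 0 = m ∧ (∀ i ≠ m, s₂.real 3 i = s'.real 3 i) ∧
      (∀ j < l, s₂.real 3 m j = reweight k g E μ m j) ∧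
      ∀ j ≥ l, s₂.real 3 m j = s.real 3 m j) (by
        simp [sizeExp, NExp.eval, hF₁.nat 0 (by simp), hN])
      ⟨hF₁, by simp, by simp, by simp, by intro j _; simp [hs'' m le_rfl]⟩ ?_) ?_
  · rintro l hl s₂ ⟨hF₂, h1, h2, h3, h4⟩
    have hF₃ := hF₂.setNat (x := 2) (by simp) 0 0 l
    have e1 : (s₂.setNat 2 0 0 l).nat 1 0 0 = m := by
      rw [Store.setNat_nat_ne _ (by norm_num), h1]
    have e2 : (s₂.setNat 2 0 0 l).nat 2 0 0 = l := by simp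
    refine ⟨⟨hF₃.setReal (by simp) _ _ _, ?_, ?_, ?_, ?_⟩,
      by simp [Cmd.run, NExp.cost, RExp.cost, NExp.var]⟩
    · simpa [Cmd.run] using e1
    · intro i hi
      funext j
      simp only [Cmd.run, NExp.eval_var, e1, e2]
      rw [Store.setReal_real_of_ne _ _ _ (Or.inl hi)]
      simp [h2 i hi]
    · intro j hj
      simp only [Cmd.run, NExp.eval_var, e1, e2]
      rcases Nat.lt_succ_iff_lt_or_eq.1 hj with hj | rfl
      · rw [Store.setReal_real_of_ne _ _ _ (Or.inr hj.ne)]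
        exact h3 j hj
      · simp only [Store.setReal_real_same, RExp.eval, NExp.eval, NExp.eval_var, e1, e2,
          hF₃.real 9 (by simp), hF₃.real 2 (by simp), hF₃.nat 4 (by simp), hk, hμ m hm, hg j hl,
          Store.setNat_real, h4 j le_rfl, hE m hm j hl, reweight, Nat.cast_one]
    · intro j hj
      simp only [Cmd.run, NExp.eval_var, e1, e2]
      rw [Store.setReal_real_of_ne _ _ _ (Or.inr (by omega))]
      exact h4 j (by omega)
  · rintro s₂ ⟨hF₂, h1, h2, h3, h4⟩
    refine ⟨hF₂, ?_, ?_⟩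
    · intro i hi j hj
      rcases Nat.lt_succ_iff_lt_or_eq.1 hi with hi | rfl
      · rw [h2 i hi.ne]; exact hs' i hi j hj
      · exact h3 j hj
    · intro i hi
      rw [h2 i (by omega)]
      exact hs'' i (by omega)

theorem spec_walkStepCmd {s : Store} {E : ℕ → ℕ → ℝ} {c b : ℕ → ℝ}
    (hN : s.nat 0 0 2 = N) (hE : ∀ i < N, ∀ j < N, s.real 3 i j = E i j)
    (hW : ∀ i < N, s.real 4 i 0 = rowWeight N E i) (hc : ∀ i < N, s.real 6 i 0 = c i)
    (hb : ∀ i < N, s.real 7 i 0 = b i) :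
    Spec Q walkStepCmd s (fun s₁ => Frame [1, 2, 3] [6, 7, 8, 10] s s₁ ∧
      (∀ i < N, s₁.real 6 i 0 = transition N E c i) ∧ ∀ i < N, s₁.real 7 i 0 = b i + c i)
      ((4 + N * 17) + ((4 + N * (18 + N * 30)) + (4 + N * 11))) := by
  refine Spec.seq (spec_vecMapCmd (f := fun i => b i + c i) (N₀ := N) hN ?_) ?_
  · intro s' i hF hi h1 h7
    simp [RExp.eval, NExp.eval, h1, h7, hb i hi, hF.real 6 (by simp), hc i hi]
  rintro s₁ ⟨hF₁, h7⟩
  refine Spec.seq ((spec_vecSumCmd (N₀ := N) (n₀ := N)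
    (f := fun j i => c i * ((1 + E i j) / rowWeight N E i)) (by norm_num) ?_ ?_ ?_).mono ?_) ?_
  · simp [sizeExp, NExp.eval, hF₁.nat 0 (by simp), hN]
  · intro s' hF
    simp [sizeExp, NExp.eval, hF.nat 0 (by simp), hF₁.nat 0 (by simp), hN]
  · intro s' j i hF hj hi h1 h2
    simp [RExp.eval, NExp.eval, h1, h2, hF.real 6 (by simp), hF.real 3 (by simp),
      hF.real 4 (by simp), hF₁.real 6 (by simp), hF₁.real 3 (by simp),
      hF₁.real 4 (by simp), hc i hi, hE i hi j hj, hW i hi]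
  · apply le_of_eq; simp only [sizeExp, NExp.cost, RExp.cost, NExp.var]; ring
  rintro s₂ ⟨hF₂, h8⟩
  refine (spec_vecMapCmd (N₀ := N) (f := transition N E c) ?_ ?_).imp ?_
  · simp [sizeExp, NExp.eval, hF₂.nat 0 (by simp), hF₁.nat 0 (by simp), hN]
  · intro s' i hF hi h1 _
    simp [RExp.eval, NExp.eval, h1, hF.real 8 (by simp), h8 i hi, transition]
  · rintro s₃ ⟨hF₃, h6⟩
    refine ⟨((hF₁.mono (by simp) (by simp)).trans (hF₂.mono (by simp) (by simp))).trans
      (hF₃.mono (by simp) (by simp)), h6, ?_⟩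
    intro i hi
    rw [hF₃.real 7 (by simp), hF₂.real 7 (by simp), h7 i hi]

theorem spec_averagedWalkCmd {s : Store} {E : ℕ → ℕ → ℝ}
    (hT : s.nat 0 0 1 = T) (hN : s.nat 0 0 2 = N) (hE : ∀ i < N, ∀ j < N, s.real 3 i j = E i j)
    (hW : ∀ i < N, s.real 4 i 0 = rowWeight N E i) :
    Spec Q averagedWalkCmd s (fun s₁ => Frame [1, 2, 3] [6, 7, 8, 9, 10] s s₁ ∧
      ∀ i < N, s₁.real 9 i 0 = averagedWalk T N E i)
      ((4 + N * 13) + ((4 + N * 8) + ((4 + T * ((4 + N * 17) + ((4 + N * (18 + N * 30)) +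
        (4 + N * 11)) + 1)) + (4 + N * 16)))) := by
  refine Spec.seq (spec_vecMapCmd (f := fun _ => 1 / (N : ℝ)) (N₀ := N) hN ?_) ?_
  · intro s' i hF hi h1 h7
    simp [RExp.eval, NExp.eval, sizeExp, hF.nat 0 (by simp), hN]
  rintro s₁ ⟨hF₁, h6⟩
  refine Spec.seq (spec_vecMapCmd (f := fun _ => 0) (N₀ := N) ?_ ?_) ?_
  · simp [sizeExp, NExp.eval, hF₁.nat 0 (by simp), hN]
  · intro s' i hF hi h1 h7
    simp [RExp.eval, NExp.eval]
  rintro s₂ ⟨hF₂, h7⟩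
  have hF₁₂ : Frame [1, 2, 3] [6, 7, 8, 10] s s₂ :=
    (hF₁.mono (by simp) (by simp)).trans (hF₂.mono (by simp) (by simp))
  refine Spec.seq (Spec.loop (n := T) (fun m s' => Frame [1, 2, 3] [6, 7, 8, 10] s s' ∧
    (∀ i < N, s'.real 6 i 0 = walk N E m i) ∧
    ∀ i < N, s'.real 7 i 0 = ∑ l ∈ Finset.range m, walk N E l i) ?_ ⟨hF₁₂, ?_, ?_⟩ ?_) ?_
  · simp [horizonExp, NExp.eval, hF₁₂.nat 0 (by simp), hT]
  · intro i hi
    rw [hF₂.real 6 (by simp), h6 i hi]; rfl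
  · intro i hi; simp [h7 i hi]
  · rintro m hm s' ⟨hF', h6', h7'⟩
    have hF₃ := hF'.setNat (x := 3) (by simp) 0 0 m
    refine Spec.imp (spec_walkStepCmd (E := E) (c := walk N E m)
      (b := fun i => ∑ l ∈ Finset.range m, walk N E l i) ?_ ?_ ?_ h6' h7') ?_
    · rw [hF₃.nat 0 (by simp), hN]
    · rw [hF₃.real 3 (by simp)]; exact hE
    · rw [hF₃.real 4 (by simp)]; exact hW
    · rintro s₄ ⟨hF₄, h6₄, h7₄⟩
      refine ⟨hF₃.trans hF₄, ?_, ?_⟩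
      · intro i hi
        rw [h6₄ i hi, walk, walk, Function.iterate_succ_apply']
      · intro i hi
        rw [h7₄ i hi, Finset.sum_range_succ]
  rintro s₃ ⟨hF₃, -, h7₃⟩
  refine (spec_vecMapCmd (N₀ := N) (f := averagedWalk T N E) ?_ ?_).imp ?_
  · simp [sizeExp, NExp.eval, hF₃.nat 0 (by simp), hN]
  · intro s' i hF hi h1 _
    simp [RExp.eval, NExp.eval, h1, horizonExp, hF.real 7 (by simp), hF.nat 0 (by simp),
      hF₃.nat 0 (by simp), h7₃ i hi, averagedWalk, hT]
  · rintro s₄ ⟨hF₄, h9⟩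
    exact ⟨(hF₃.mono (by simp) (by simp)).trans (hF₄.mono (by simp) (by simp)), h9⟩

theorem spec_outputCmd {s : Store} {z : ℕ → EuclideanSpace ℝ (Fin d)} {μ : ℕ → ℝ} {τ : ℕ}
    (hN : s.nat 0 0 2 = N) (hz : ∀ i < N, ∀ l : Fin d, s.real 0 i l = z i l)
    (hμ : ∀ i < N, s.real 9 i 0 = μ i) (hτ : ∀ i < N, (Q (z i)).2 ≤ τ)
    (hlen : ∀ i < N, (Q (z i)).1.length ≤ τ) :
    Spec Q outputCmd s (fun s₁ => (∀ a ∉ [1, 2, 5], s₁.nat a = s.nat a) ∧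
      (∀ a ∉ [5], s₁.real a = s.real a) ∧
      s₁.out = s.out ++ (List.range N).flatMap fun k =>
        (Q (z k)).1.map fun e => (e.1, μ k * e.2))
      (4 + N * ((4 + d + τ) + (4 + τ * 22) + 1)) := by
  refine Spec.loop (fun m s' => (∀ a ∉ [1, 2, 5], s'.nat a = s.nat a) ∧
      (∀ a ∉ [5], s'.real a = s.real a) ∧
      s'.out = s.out ++ (List.range m).flatMap fun k =>
        (Q (z k)).1.map fun e => (e.1, μ k * e.2)) hN ⟨by simp, by simp, by simp⟩ ?_
  rintro k hk s' ⟨h1, h2, h3⟩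
  have hvec : (s'.setNat 1 0 0 k).vec d 0 k = z k := by
    ext l
    simp [Store.vec, h2 0 (by simp), hz k hk l]
  set L := (Q (z k)).1 with hL
  refine Spec.seq (P := fun s₁ => s₁ = (s'.setNat 1 0 0 k).writeList 5 L) ⟨?_, ?_⟩ ?_
  · simp [Cmd.run, hvec, hL]
  · have := hτ k hk
    simp only [Cmd.run, NExp.eval_var, Store.setNat_nat_same, hvec]
    simp only [NExp.var, NExp.cost]
    omega
  rintro s₁ hs₁
  have hn : s₁.nat 5 0 0 = L.length := by simp [hs₁, Store.writeList]
  have hn1 : s₁.nat 1 0 0 = k := by simp [hs₁, Store.writeList]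
  have hr : s₁.real 9 k 0 = μ k := by
    simp [hs₁, Store.writeList, h2 9 (by simp), hμ k hk]
  have hna : ∀ j (hj : j < L.length), s₁.nat 5 (j + 1) 0 = L[j].1 := by
    intro j hj
    simp [hs₁, Store.writeList, Nat.succ_le_of_lt hj, hj]
  have hra : ∀ j (hj : j < L.length), s₁.real 5 (j + 1) 0 = L[j].2 := by
    intro j hj
    simp [hs₁, Store.writeList, Nat.succ_le_of_lt hj, hj]
  have hnat : ∀ a ∉ [1, 2, 5], s₁.nat a = s.nat a := by
    intro a ha
    rw [← h1 a ha]
    simp only [List.mem_cons, List.not_mem_nil, or_false, not_or] at ha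
    funext i j
    simp [hs₁, Store.writeList, ha, Store.setNat]
  have hreal : ∀ a ∉ [5], s₁.real a = s.real a := by
    intro a ha
    rw [← h2 a ha]
    simp only [List.mem_cons, List.not_mem_nil, or_false] at ha
    funext i j
    simp [hs₁, Store.writeList, ha]
  have hout : s₁.out = s'.out := by rw [hs₁]; rfl
  clear hs₁
  refine ((Spec.loop (B := 21) (fun m s₂ => (∀ a ≠ 2, s₂.nat a = s₁.nat a) ∧
      s₂.real = s₁.real ∧ s₂.out = s₁.out ++ (L.take m).map fun e => (e.1, μ k * e.2))
    (n := L.length) (by rw [NExp.eval_var, hn]) ⟨by simp, rfl, by simp⟩ ?_).imp ?_).mono ?_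
  · rintro j hj s₂ ⟨g1, g2, g3⟩
    refine ⟨⟨?_, ?_, ?_⟩, by simp [Cmd.run, NExp.cost, RExp.cost, NExp.var]⟩
    · intro a ha
      simp [Cmd.run, Store.setNat_nat_ne _ ha, g1 a ha]
    · simp [Cmd.run, g2]
    · have e5 : (s₂.setNat 2 0 0 j).nat 5 = s₁.nat 5 := by
        rw [Store.setNat_nat_ne _ (by norm_num), g1 5 (by norm_num)]
      have e1 : (s₂.setNat 2 0 0 j).nat 1 = s₁.nat 1 := by
        rw [Store.setNat_nat_ne _ (by norm_num), g1 1 (by norm_num)]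
      simp only [Cmd.run, NExp.eval, RExp.eval, NExp.eval_var, Store.setNat_nat_same, e5, e1,
        hna j hj, hra j hj, Store.setNat_real, g2, hn1, hr, Store.setNat_out, g3]
      rw [List.take_succ_eq_append_getElem hj, List.map_append, List.append_assoc]
      rfl
  · rintro s₂ ⟨g1, g2, g3⟩
    refine ⟨?_, ?_, ?_⟩
    · intro a ha
      rw [← hnat a ha]
      exact g1 a (by rintro rfl; simp at ha)
    · intro a ha
      rw [g2, hreal a ha]
    · rw [g3, hout, h3, List.take_length, List.range_succ, List.flatMap_append]
      simp [hL]
  · have := hlen k hk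
    have h4 : L.length * 22 ≤ τ * 22 := Nat.mul_le_mul_right _ this
    show 3 + 1 + L.length * 22 ≤ _
    omega

/-- The store holds the dimension, the horizon, the points `z`, the observation `y`, the weights
`1 + E` and the distribution `μ` of the last round. -/
structure Holds (T N : ℕ) (z : ℕ → EuclideanSpace ℝ (Fin d)) (y : EuclideanSpace ℝ (Fin d))
    (E : ℕ → ℕ → ℝ) (μ : ℕ → ℝ) (s : Store) : Prop where
  dim : s.nat 0 0 0 = d
  horizon : s.nat 0 0 1 = T
  size : s.nat 0 0 2 = N
  points : ∀ i < N, ∀ l : Fin d, s.real 0 i l = z i l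
  obs : ∀ l : Fin d, s.real 1 0 l = y l
  weights : ∀ i < N, ∀ j < N, s.real 3 i j = E i j
  dist : ∀ i < N, s.real 9 i 0 = μ i

theorem spec_learnerCmd {s : Store} {z : ℕ → EuclideanSpace ℝ (Fin d)}
    {y : EuclideanSpace ℝ (Fin d)} {E E' : ℕ → ℕ → ℝ} {μ μ' : ℕ → ℝ} {τ : ℕ}
    (hs : Holds T N z y E μ s) (hout : s.out = [])
    (hE' : E' = reweight (inverseRate T N) (fun j => inner ℝ (z j) y) E μ)
    (hμ' : μ' = averagedWalk T N E')
    (hτ : ∀ i < N, (Q (z i)).2 ≤ τ) (hlen : ∀ i < N, (Q (z i)).1.length ≤ τ) :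
    Spec Q learnerCmd s (fun s₁ => Holds T N z y E' μ' s₁ ∧
      s₁.out = (List.range N).flatMap fun k => (Q (z k)).1.map fun e => (e.1, μ' k * e.2))
      (400 * (d + T + N + τ + 1) ^ 3) := by
  subst hμ' hE'
  unfold learnerCmd gainCmd rowWeightCmd
  -- The bounds for the six stages added up; afterwards each monomial is at most the cube of `d + T
  -- + N + τ + 1`.
  refine Spec.mono (B := 4 + (4 + T * 29) + (4 + N * (5 + (4 + d * 21) + 8 + 1) +
    (4 + N * (4 + N * 42 + 1) + (4 + N * (5 + (4 + N * 18) + 8 + 1) + ((4 + N * 13) +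
      ((4 + N * 8) + ((4 + T * ((4 + N * 17) + ((4 + N * (18 + N * 30)) + (4 + N * 11)) + 1)) +
        (4 + N * 16))) + (4 + N * ((4 + d + τ) + (4 + τ * 22) + 1))))))) ?_ ?_
  · refine Spec.seq (spec_rateCmd hs.horizon hs.size) ?_
    rintro s₁ ⟨hF₁, hk⟩
    refine Spec.seq (spec_vecSumCmd (a := 2) (N₀ := N) (n₀ := d)
      (f := fun i l => s.real 0 i l * s.real 1 0 l) (by norm_num) ?_ ?_ ?_) ?_
    · simp [sizeExp, NExp.eval, hF₁.nat 0 (by simp), hs.size]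
    · intro s' hF
      simp [dimExp, NExp.eval, hF.nat 0 (by simp), hF₁.nat 0 (by simp), hs.dim]
    · intro s' i l hF hi hl h1 h2
      simp [RExp.eval, NExp.eval, h1, h2, hF.real 0 (by simp), hF.real 1 (by simp),
        hF₁.real 0 (by simp), hF₁.real 1 (by simp)]
    rintro s₂ ⟨hF₂, hg⟩
    have hg' : ∀ j < N, s₂.real 2 j 0 = inner ℝ (z j) y := by
      intro j hj
      rw [hg j hj, Finset.sum_range fun l => s.real 0 j l * s.real 1 0 l, PiLp.inner_apply]
      refine Finset.sum_congr rfl fun l _ => ?_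
      rw [hs.points j hj, hs.obs]
      simp [mul_comm]
    have hF₁₂ : Frame [1, 2, 4] [2, 10] s s₂ :=
      (hF₁.mono (by simp) (by simp)).trans (hF₂.mono (by simp) (by simp))
    refine Spec.seq (spec_reweightCmd (g := fun j => inner ℝ (z j) y) (E := E) (μ := μ) (N := N)
      (k := inverseRate T N) ?_ ?_ hg' ?_ ?_) ?_
    · rw [hF₁₂.nat 0 (by simp), hs.size]
    · rw [hF₂.nat 4 (by simp), hk]
    · rw [hF₁₂.real 9 (by simp)]; exact hs.dist
    · rw [hF₁₂.real 3 (by simp)]; exact hs.weights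
    rintro s₃ ⟨hF₃, hE⟩
    have hF₁₃ : Frame [1, 2, 4] [2, 3, 10] s s₃ :=
      (hF₁₂.mono (by simp) (by simp)).trans (hF₃.mono (by simp) (by simp))
    set E' := reweight (inverseRate T N) (fun j => inner ℝ (z j) y) E μ with hE'
    refine Spec.seq (spec_vecSumCmd (a := 4) (N₀ := N) (n₀ := N) (f := fun i j => 1 + E' i j)
      (by norm_num) ?_ ?_ ?_) ?_
    · simp [sizeExp, NExp.eval, hF₁₃.nat 0 (by simp), hs.size]
    · intro s' hF
      simp [sizeExp, NExp.eval, hF.nat 0 (by simp), hF₁₃.nat 0 (by simp), hs.size]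
    · intro s' i l hF hi hl h1 h2
      simp [RExp.eval, NExp.eval, h1, h2, hF.real 3 (by simp), hE i hi l hl]
    rintro s₄ ⟨hF₄, hW⟩
    have hF₁₄ : Frame [1, 2, 4] [2, 3, 4, 10] s s₄ :=
      (hF₁₃.mono (by simp) (by simp)).trans (hF₄.mono (by simp) (by simp))
    refine Spec.seq (spec_averagedWalkCmd (T := T) (N := N) (E := E') ?_ ?_ ?_ hW) ?_
    · rw [hF₁₄.nat 0 (by simp), hs.horizon]
    · rw [hF₁₄.nat 0 (by simp), hs.size]
    · rw [hF₄.real 3 (by simp)]; exact hE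
    rintro s₅ ⟨hF₅, hμ⟩
    have hF₁₅ : Frame [1, 2, 3, 4] [2, 3, 4, 6, 7, 8, 9, 10] s s₅ :=
      (hF₁₄.mono (by simp) (by simp)).trans (hF₅.mono (by simp) (by simp))
    refine (spec_outputCmd (N := N) (z := z) (μ := averagedWalk T N E') (τ := τ) ?_ ?_ hμ
      hτ hlen).imp ?_
    · rw [hF₁₅.nat 0 (by simp), hs.size]
    · rw [hF₁₅.real 0 (by simp)]; exact hs.points
    rintro s₆ ⟨g1, g2, g3⟩
    refine ⟨⟨?_, ?_, ?_, ?_, ?_, ?_, ?_⟩, ?_⟩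
    · rw [g1 0 (by simp), hF₁₅.nat 0 (by simp), hs.dim]
    · rw [g1 0 (by simp), hF₁₅.nat 0 (by simp), hs.horizon]
    · rw [g1 0 (by simp), hF₁₅.nat 0 (by simp), hs.size]
    · rw [g2 0 (by simp), hF₁₅.real 0 (by simp)]; exact hs.points
    · rw [g2 1 (by simp), hF₁₅.real 1 (by simp)]; exact hs.obs
    · rw [g2 3 (by simp), hF₅.real 3 (by simp), hF₄.real 3 (by simp)]; exact hE
    · rw [g2 9 (by simp)]; exact hμ
    · rw [g3, hF₁₅.out, hout, List.nil_append]
  · set M := d + T + N + τ + 1 with hM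
    have hd : d ≤ M := by omega
    have hT : T ≤ M := by omega
    have hN : N ≤ M := by omega
    have hτ : τ ≤ M := by omega
    have h1 : 1 ≤ M := by omega
    have h3 : ∀ a b c : ℕ, a ≤ M → b ≤ M → c ≤ M → a * b * c ≤ M ^ 3 := by
      intro a b c ha hb hc
      calc a * b * c ≤ M * M * M := Nat.mul_le_mul (Nat.mul_le_mul ha hb) hc
        _ = M ^ 3 := by ring
    linarith [h3 1 1 1 h1 h1 h1, h3 T 1 1 hT h1 h1, h3 N 1 1 hN h1 h1, h3 N N 1 hN hN h1,
      h3 N d 1 hN hd h1, h3 N τ 1 hN hτ h1, h3 T N 1 hT hN h1, h3 T N N hT hN hN]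

end RealRAM

/-! ### The averaged random walk is nearly stationary -/

section Walk

variable {N : ℕ} {E : ℕ → ℕ → ℝ}

theorem rowWeight_pos (hN : 0 < N) (hE : ∀ i < N, ∀ j < N, 0 < 1 + E i j) {i : ℕ} (hi : i < N) :
    0 < rowWeight N E i :=
  Finset.sum_pos (fun j hj => hE i hi j (Finset.mem_range.1 hj)) ⟨0, Finset.mem_range.2 hN⟩

/-- Duality: the mean of `g` after a step of the chain is the mean of its row averages before it.
This turns stationarity into a comparison of consecutive steps of the walk. -/
theorem sum_transition_mul (N : ℕ) (E : ℕ → ℕ → ℝ) (c g : ℕ → ℝ) :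
    ∑ j ∈ Finset.range N, transition N E c j * g j =
      ∑ i ∈ Finset.range N, c i * ((∑ j ∈ Finset.range N, (1 + E i j) * g j) /
        rowWeight N E i) := by
  simp only [transition, Finset.sum_mul]
  rw [Finset.sum_comm]
  refine Finset.sum_congr rfl fun i _ => ?_
  rw [Finset.sum_div, Finset.mul_sum]
  exact Finset.sum_congr rfl fun j _ => by ring

theorem walk_succ (N : ℕ) (E : ℕ → ℕ → ℝ) (m : ℕ) :
    walk N E (m + 1) = transition N E (walk N E m) := by
  rw [walk, walk, Function.iterate_succ_apply']

theorem walk_nonneg (hN : 0 < N) (hE : ∀ i < N, ∀ j < N, 0 < 1 + E i j) (m : ℕ) :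
    ∀ j < N, 0 ≤ walk N E m j := by
  induction m with
  | zero => intro j _; simp [walk]
  | succ m ih =>
    intro j hj
    rw [walk_succ]
    refine Finset.sum_nonneg fun i hi => ?_
    have hi := Finset.mem_range.1 hi
    exact mul_nonneg (ih i hi) (div_nonneg (hE i hi j hj).le (rowWeight_pos hN hE hi).le)

theorem sum_walk (hN : 0 < N) (hE : ∀ i < N, ∀ j < N, 0 < 1 + E i j) (m : ℕ) :
    ∑ j ∈ Finset.range N, walk N E m j = 1 := by
  induction m with
  | zero =>
    have : (N : ℝ) ≠ 0 := by exact_mod_cast hN.ne'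
    simp [walk, this]
  | succ m ih =>
    have h := sum_transition_mul N E (walk N E m) fun _ => 1
    simp only [mul_one] at h
    rw [walk_succ, h]
    refine (Finset.sum_congr rfl fun i hi => ?_).trans ih
    have hpos := rowWeight_pos hN hE (Finset.mem_range.1 hi)
    have : ∑ j ∈ Finset.range N, (1 + E i j) = rowWeight N E i := rfl
    rw [this, div_self hpos.ne', mul_one]

theorem averagedWalk_nonneg (hN : 0 < N) (hE : ∀ i < N, ∀ j < N, 0 < 1 + E i j) (T : ℕ) :
    ∀ j < N, 0 ≤ averagedWalk T N E j := fun j hj =>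
  div_nonneg (Finset.sum_nonneg fun m _ => walk_nonneg hN hE m j hj) (Nat.cast_nonneg T)

theorem sum_averagedWalk_mul (T N : ℕ) (E : ℕ → ℕ → ℝ) (g : ℕ → ℝ) :
    ∑ j ∈ Finset.range N, averagedWalk T N E j * g j =
      (∑ m ∈ Finset.range T, ∑ j ∈ Finset.range N, walk N E m j * g j) / T := by
  rw [Finset.sum_comm, Finset.sum_div]
  refine Finset.sum_congr rfl fun j _ => ?_
  rw [averagedWalk, div_mul_eq_mul_div, Finset.sum_mul]

theorem sum_averagedWalk (hN : 0 < N) (hE : ∀ i < N, ∀ j < N, 0 < 1 + E i j) {T : ℕ}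
    (hT : 0 < T) : ∑ j ∈ Finset.range N, averagedWalk T N E j = 1 := by
  have h := sum_averagedWalk_mul T N E fun _ => 1
  simp only [mul_one, sum_walk hN hE] at h
  rw [h]
  have : (T : ℝ) ≠ 0 := by exact_mod_cast hT.ne'
  simp [this]

/-- By duality the left side averages the means of `g` over the steps `1, …, T` and the right side
over `0, …, T - 1`. The difference telescopes to two terms of absolute value at most `1`; no mixing
of the chain is required. -/
theorem averagedWalk_nearly_stationary (hN : 0 < N) (hE : ∀ i < N, ∀ j < N, 0 < 1 + E i j)
    (T : ℕ) {g : ℕ → ℝ} (hg : ∀ j < N, |g j| ≤ 1) :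
    ∑ i ∈ Finset.range N, averagedWalk T N E i *
        ((∑ j ∈ Finset.range N, (1 + E i j) * g j) / ∑ j ∈ Finset.range N, (1 + E i j)) ≤
      ∑ i ∈ Finset.range N, averagedWalk T N E i * g i + 2 / T := by
  have hb : ∀ m, |∑ j ∈ Finset.range N, walk N E m j * g j| ≤ 1 := by
    intro m
    rw [← sum_walk hN hE m]
    refine (Finset.abs_sum_le_sum_abs _ _).trans (Finset.sum_le_sum fun j hj => ?_)
    have hj := Finset.mem_range.1 hj
    have h0 := walk_nonneg hN hE m j hj
    rw [abs_mul, abs_of_nonneg h0]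
    nlinarith [hg j hj]
  have h1 := sum_averagedWalk_mul T N E
    fun i => (∑ j ∈ Finset.range N, (1 + E i j) * g j) / rowWeight N E i
  simp only [← sum_transition_mul, ← walk_succ] at h1
  rw [sum_transition_mul] at h1
  have h2 : ∑ i ∈ Finset.range N, averagedWalk T N E i *
      ((∑ j ∈ Finset.range N, (1 + E i j) * g j) / ∑ j ∈ Finset.range N, (1 + E i j)) =
      (∑ m ∈ Finset.range T, ∑ j ∈ Finset.range N, walk N E (m + 1) j * g j) / T := h1
  rw [h2, sum_averagedWalk_mul, ← add_div]
  gcongr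
  have h3 := Finset.sum_range_succ (fun m => ∑ j ∈ Finset.range N, walk N E m j * g j) T
  have h4 := Finset.sum_range_succ' (fun m => ∑ j ∈ Finset.range N, walk N E m j * g j) T
  have h5 := (abs_le.1 (hb T)).2
  have h6 := (abs_le.1 (hb 0)).1
  linarith

end Walk

/-! ### The learning rate -/

theorem two_le_inverseRate (T N : ℕ) : 2 ≤ inverseRate T N := by
  have : ∀ m, 2 ≤ (fun k => if k * k * N < T then k + 1 else k)^[m] 2 := by
    intro m
    induction m with
    | zero => simp
    | succ m ih =>
      rw [Function.iterate_succ_apply']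
      split_ifs <;> omega
  exact this T

/-- At every stage the search has either succeeded or advanced each time. After `T` advances `k ≥ T
+ 2`, and then `T ≤ k² N` anyway, so `T` iterations suffice. -/
theorem le_inverseRate_sq (T : ℕ) {N : ℕ} (hN : 0 < N) :
    T ≤ inverseRate T N * inverseRate T N * N := by
  have : ∀ m, m + 2 ≤ (fun k => if k * k * N < T then k + 1 else k)^[m] 2 ∨
      T ≤ (fun k => if k * k * N < T then k + 1 else k)^[m] 2 *
        (fun k => if k * k * N < T then k + 1 else k)^[m] 2 * N := by
    intro m
    induction m with
    | zero => simp
    | succ m ih =>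
      rw [Function.iterate_succ_apply']
      split_ifs with h <;> omega
  rcases this T with h | h
  · change T + 2 ≤ inverseRate T N at h
    calc T ≤ inverseRate T N := by omega
      _ ≤ inverseRate T N * inverseRate T N := Nat.le_mul_self _
      _ ≤ _ := Nat.le_mul_of_pos_right _ hN
  · exact h

/-- Minimality of the search result above its starting value; it keeps the term `N k log N` of the
regret small. -/
theorem inverseRate_eq_two_or (T N : ℕ) : inverseRate T N = 2 ∨
    (inverseRate T N - 1) * (inverseRate T N - 1) * N < T := by
  have : ∀ m, (fun k => if k * k * N < T then k + 1 else k)^[m] 2 = 2 ∨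
      ((fun k => if k * k * N < T then k + 1 else k)^[m] 2 - 1) *
        ((fun k => if k * k * N < T then k + 1 else k)^[m] 2 - 1) * N < T := by
    intro m
    induction m with
    | zero => simp
    | succ m ih =>
      rw [Function.iterate_succ_apply']
      split_ifs with h
      · right; simpa using h
      · exact ih
  exact this T

/-! ### The trajectory of the learner -/

section Trajectory

variable {d : ℕ} (T N : ℕ) (z : ℕ → EuclideanSpace ℝ (Fin d))

/-- Weights minus one, distribution and observation of the last round. -/
abbrev LearnerState (d : ℕ) : Type := (ℕ → ℕ → ℝ) × (ℕ → ℝ) × EuclideanSpace ℝ (Fin d)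

noncomputable def nextWeights (p : LearnerState d) : ℕ → ℕ → ℝ :=
  reweight (inverseRate T N) (fun j => inner ℝ (z j) p.2.2) p.1 p.2.1

noncomputable def nextState (p : LearnerState d) (y : EuclideanSpace ℝ (Fin d)) : LearnerState d :=
  (nextWeights T N z p, averagedWalk T N (nextWeights T N z p), y)

/-- The state of the learner after the observations `ys`. -/
noncomputable def stateAfter (ys : List (EuclideanSpace ℝ (Fin d))) : LearnerState d :=
  ys.foldl (nextState T N z) (0, 0, 0)

/-- The distribution on the points `z` that is played after the observations `ys`. -/
noncomputable def playedDist (ys : List (EuclideanSpace ℝ (Fin d))) : ℕ → ℝ :=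
  averagedWalk T N (nextWeights T N z (stateAfter T N z ys))

variable {T N z}

theorem stateAfter_append (ys : List (EuclideanSpace ℝ (Fin d))) (y : EuclideanSpace ℝ (Fin d)) :
    stateAfter T N z (ys ++ [y]) = nextState T N z (stateAfter T N z ys) y := by
  simp [stateAfter]

/-- Zeroed memory encodes unit weights, and with observation zero the update changes nothing, so the
program needs no special first round. -/
theorem nextWeights_nil (i j : ℕ) : nextWeights T N z (stateAfter T N z []) i j = 0 := by
  simp [nextWeights, stateAfter, reweight]

theorem one_add_nextWeights_append (ys : List (EuclideanSpace ℝ (Fin d)))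
    (y : EuclideanSpace ℝ (Fin d)) (i j : ℕ) :
    1 + nextWeights T N z (stateAfter T N z (ys ++ [y])) i j =
      (1 + nextWeights T N z (stateAfter T N z ys) i j) *
        (1 + (inverseRate T N : ℝ)⁻¹ * playedDist T N z ys i * inner ℝ (z j) y) := by
  rw [stateAfter_append]
  simp only [nextWeights, nextState, reweight, playedDist]
  ring

theorem abs_inner_le_one {x y : EuclideanSpace ℝ (Fin d)} (hx : ‖x‖ ≤ 1) (hy : ‖y‖ ≤ 1) :
    |inner ℝ x y| ≤ 1 :=
  (abs_real_inner_le_norm x y).trans (mul_le_one₀ hx (norm_nonneg y) hy)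

theorem inverseRate_inv_pos (T N : ℕ) : 0 < (inverseRate T N : ℝ)⁻¹ := by
  have : 0 < inverseRate T N := (two_le_inverseRate T N).trans_lt' (by norm_num)
  positivity

theorem inverseRate_inv_le (T N : ℕ) : (inverseRate T N : ℝ)⁻¹ ≤ 1 / 2 := by
  have : (2 : ℝ) ≤ inverseRate T N := by exact_mod_cast two_le_inverseRate T N
  rw [inv_eq_one_div]
  gcongr

/-- Positive weights make the played vector a distribution, so its entries are at most `1`; with a
rate of at most `1/2` the next update factors are then positive. -/
theorem one_add_nextWeights_pos (hN : 0 < N) (hT : 0 < T) (hz : ∀ i < N, ‖z i‖ ≤ 1)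
    (ys : List (EuclideanSpace ℝ (Fin d))) (hys : ∀ y ∈ ys, ‖y‖ ≤ 1) :
    ∀ i < N, ∀ j < N, 0 < 1 + nextWeights T N z (stateAfter T N z ys) i j := by
  induction ys using List.reverseRecOn with
  | nil => intro i _ j _; rw [nextWeights_nil]; norm_num
  | append_singleton ys y ih =>
    intro i hi j hj
    have ih := ih fun y hy => hys y (by simp [hy])
    rw [one_add_nextWeights_append]
    refine mul_pos (ih i hi j hj) ?_
    have h0 := averagedWalk_nonneg hN ih T i hi
    have h1 : playedDist T N z ys i ≤ 1 := by
      rw [← sum_averagedWalk hN ih hT]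
      exact Finset.single_le_sum (f := fun i => playedDist T N z ys i)
        (fun i hi => averagedWalk_nonneg hN ih T i (Finset.mem_range.1 hi)) (Finset.mem_range.2 hi)
    have h2 := abs_le.1 (abs_inner_le_one (hz j hj) (hys y (by simp)))
    have h3 := inverseRate_inv_pos T N
    have h4 := inverseRate_inv_le T N
    change 0 ≤ playedDist T N z ys i at h0
    have h5 : (inverseRate T N : ℝ)⁻¹ * playedDist T N z ys i ≤ 1 / 2 := by nlinarith
    have h6 : 0 ≤ (inverseRate T N : ℝ)⁻¹ * playedDist T N z ys i := by positivity
    nlinarith [h2.1]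

theorem playedDist_nonneg (hN : 0 < N) (hT : 0 < T) (hz : ∀ i < N, ‖z i‖ ≤ 1)
    (ys : List (EuclideanSpace ℝ (Fin d))) (hys : ∀ y ∈ ys, ‖y‖ ≤ 1) :
    ∀ i < N, 0 ≤ playedDist T N z ys i :=
  averagedWalk_nonneg hN (one_add_nextWeights_pos hN hT hz ys hys) T

theorem sum_playedDist (hN : 0 < N) (hT : 0 < T) (hz : ∀ i < N, ‖z i‖ ≤ 1)
    (ys : List (EuclideanSpace ℝ (Fin d))) (hys : ∀ y ∈ ys, ‖y‖ ≤ 1) :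
    ∑ i ∈ Finset.range N, playedDist T N z ys i = 1 :=
  sum_averagedWalk hN (one_add_nextWeights_pos hN hT hz ys hys) hT

/-- Swap regret of the learner on the points `z`. -/
theorem playedDist_swap_regret (hN : 0 < N) (hT : 0 < T) (hz : ∀ i < N, ‖z i‖ ≤ 1)
    (y : ℕ → EuclideanSpace ℝ (Fin d)) (hy : ∀ t < T, ‖y t‖ ≤ 1) (f : ℕ → ℕ)
    (hf : ∀ i < N, f i < N) :
    ∑ i ∈ Finset.range N, ∑ t ∈ Finset.range T, playedDist T N z ((List.range t).map y) i *
        (inner ℝ (z (f i)) (y t) - inner ℝ (z i) (y t)) ≤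
      N * Real.log N * inverseRate T N + 2 * T / inverseRate T N + 2 := by
  have hys : ∀ t ≤ T, ∀ x ∈ (List.range t).map y, ‖x‖ ≤ 1 := by
    intro t ht x hx
    obtain ⟨s, hs, rfl⟩ := List.mem_map.1 hx
    exact hy s (by have := List.mem_range.1 hs; omega)
  have hT' : (T : ℝ) ≠ 0 := by exact_mod_cast hT.ne'
  have h := swap_regret_of_nearly_stationary hN (inverseRate_inv_pos T N) (inverseRate_inv_le T N)
    T (τ := 2 / T) (fun t => playedDist T N z ((List.range t).map y))
    (fun t j => inner ℝ (z j) (y t))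
    (fun t i j => 1 + nextWeights T N z (stateAfter T N z ((List.range t).map y)) i j)
    (fun t ht => playedDist_nonneg hN hT hz _ (hys t ht.le))
    (fun t ht => sum_playedDist hN hT hz _ (hys t ht.le))
    (fun t ht j hj => abs_inner_le_one (hz j hj) (hy t ht))
    (fun i _ j _ => by simp [nextWeights_nil])
    (fun t ht i _ j _ => by
      rw [List.range_succ, List.map_append, List.map_singleton, one_add_nextWeights_append])
    (fun t ht => averagedWalk_nearly_stationary hN
      (one_add_nextWeights_pos hN hT hz _ (hys t ht.le)) T
      (fun j hj => abs_inner_le_one (hz j hj) (hy t ht))) f hf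
  refine h.trans (le_of_eq ?_)
  -- The stationarity defect `2 / T` costs `2` over all rounds.
  rw [mul_div_cancel₀ _ hT', div_inv_eq_mul]
  ring

end Trajectory

/-! ### From distributions on the discretization to mixed actions -/

theorem List.sum_map_filter_eq {α : Type*} (l : List α) (p : α → Prop) [DecidablePred p]
    (f : α → ℝ) :
    ((l.filter fun e => p e).map f).sum = (l.map fun e => if p e then f e else 0).sum := by
  induction l with
  | nil => simp
  | cons a l ih => by_cases h : p a <;> simp [h, ih]

namespace StructuredGame

variable {d n n' : ℕ} (G : StructuredGame d n n')

theorem norm_embedAdv_le (q : stdSimplex ℝ (Fin n')) : ‖G.embedAdv q‖ ≤ 1 := by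
  refine (norm_sum_le _ _).trans ?_
  rw [← q.2.2]
  refine Finset.sum_le_sum fun j _ => ?_
  have h0 : 0 ≤ (q : Fin n' → ℝ) j := q.2.1 j
  rw [norm_smul, Real.norm_of_nonneg h0]
  exact mul_le_of_le_one_right h0 (G.norm_w_le j)

theorem norm_le_of_mem_K {x : EuclideanSpace ℝ (Fin d)} (hx : x ∈ G.K) : ‖x‖ ≤ 1 := by
  have h : G.K ⊆ Metric.closedBall 0 1 := by
    refine convexHull_min ?_ (convex_closedBall 0 1)
    rintro _ ⟨i, rfl⟩
    simpa using G.norm_v_le i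
  simpa using h hx

theorem uLMixed_eq (p : Fin n → ℝ) (q : Fin n' → ℝ) :
    G.uLMixed p q = inner ℝ (∑ i, p i • G.v i) (G.embedAdv q) := by
  rw [uLMixed, embedAdv, sum_inner]
  refine Finset.sum_congr rfl fun i _ => ?_
  rw [inner_sum]
  refine Finset.sum_congr rfl fun j _ => ?_
  rw [real_inner_smul_left, real_inner_smul_right, uL, mul_assoc]

theorem sum_swapMixed_smul (φ : Fin n → Fin n) (p : Fin n → ℝ)
    (v : Fin n → EuclideanSpace ℝ (Fin d)) :
    ∑ j, swapMixed φ p j • v j = ∑ i, p i • v (φ i) := by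
  simp only [swapMixed, Finset.sum_smul]
  rw [Finset.sum_comm]
  refine Finset.sum_congr rfl fun i _ => ?_
  simp [ite_smul]

end StructuredGame

namespace DecompositionOracle

variable {d n n' : ℕ} {G : StructuredGame d n n'} (D : DecompositionOracle G)

/-- The mixed action returned by the oracle. -/
def mixed (x : EuclideanSpace ℝ (Fin d)) : Fin n → ℝ :=
  fun a => ((D.answer x).map fun e => if e.1 = a then e.2 else 0).sum

theorem sum_mixed_smul {M : Type*} [AddCommGroup M] [Module ℝ M] (x : EuclideanSpace ℝ (Fin d))
    (f : Fin n → M) :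
    ∑ a, D.mixed x a • f a = ((D.answer x).map fun e => e.2 • f e.1).sum := by
  simp only [mixed]
  induction D.answer x with
  | nil => simp
  | cons e l ih => simp [add_smul, Finset.sum_add_distrib, ih, ite_smul]

theorem mixed_mem {x : EuclideanSpace ℝ (Fin d)} (hx : x ∈ G.K) :
    D.mixed x ∈ stdSimplex ℝ (Fin n) := by
  refine ⟨fun a => ?_, ?_⟩
  · refine List.sum_nonneg fun y hy => ?_
    obtain ⟨e, he, rfl⟩ := List.mem_map.1 hy
    split_ifs
    · exact D.nonneg x hx e he
    · exact le_rfl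
  · have := D.sum_mixed_smul x fun _ => (1 : ℝ)
    simpa [D.sum_eq_one x hx] using this

theorem sum_mixed_smul_v {x : EuclideanSpace ℝ (Fin d)} (hx : x ∈ G.K) :
    ∑ a, D.mixed x a • G.v a = x := by
  rw [D.sum_mixed_smul, D.embed_eq x hx]

/-- The mixed action that plays the oracle's answers for the points `z` with weights `μ`. -/
def mixture (N : ℕ) (z : ℕ → EuclideanSpace ℝ (Fin d)) (μ : ℕ → ℝ) : Fin n → ℝ :=
  fun a => ∑ k ∈ Finset.range N, μ k * D.mixed (z k) a

variable {N : ℕ} {z : ℕ → EuclideanSpace ℝ (Fin d)} {μ : ℕ → ℝ}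

theorem mixture_mem (hz : ∀ k < N, z k ∈ G.K) (h0 : ∀ k < N, 0 ≤ μ k)
    (h1 : ∑ k ∈ Finset.range N, μ k = 1) : D.mixture N z μ ∈ stdSimplex ℝ (Fin n) := by
  refine ⟨fun a => Finset.sum_nonneg fun k hk => ?_, ?_⟩
  · have hk := Finset.mem_range.1 hk
    exact mul_nonneg (h0 k hk) ((D.mixed_mem (hz k hk)).1 a)
  · simp only [mixture]
    rw [Finset.sum_comm, ← h1]
    refine Finset.sum_congr rfl fun k hk => ?_
    rw [← Finset.mul_sum, (D.mixed_mem (hz k (Finset.mem_range.1 hk))).2, mul_one]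

theorem sum_mixture_smul (f : Fin n → EuclideanSpace ℝ (Fin d)) :
    ∑ a, D.mixture N z μ a • f a =
      ∑ k ∈ Finset.range N, μ k • ∑ a, D.mixed (z k) a • f a := by
  simp only [mixture, Finset.sum_smul, Finset.smul_sum]
  rw [Finset.sum_comm]
  simp only [mul_smul]

theorem represents_mixture : RealRAM.Represents ((List.range N).flatMap fun k =>
    (D.toQuery (z k)).1.map fun e => (e.1, μ k * e.2)) (D.mixture N z μ) := by
  refine ⟨?_, fun a => ?_⟩
  · intro e he
    simp only [toQuery, List.mem_flatMap, List.mem_map] at he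
    obtain ⟨k, _, e', ⟨e'', _, rfl⟩, rfl⟩ := he
    exact e''.1.2
  · have hinner : ∀ k, ((((D.toQuery (z k)).1.map fun e => (e.1, μ k * e.2)).filter
        fun e => e.1 = a.val).map fun e => e.2).sum = μ k * D.mixed (z k) a := by
      intro k
      rw [List.sum_map_filter_eq _ (fun e : ℕ × ℝ => e.1 = a.val)]
      simp only [toQuery, mixed, List.map_map]
      rw [← List.sum_map_mul_left]
      refine congrArg List.sum (List.map_congr_left fun e _ => ?_)
      simp [Function.comp, Fin.ext_iff]
    simp only [mixture]
    induction N with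
    | zero => simp
    | succ N ih =>
      rw [List.range_succ, List.flatMap_append, List.filter_append, List.map_append,
        List.sum_append, ← ih, Finset.sum_range_succ, List.flatMap_singleton, hinner]

end DecompositionOracle

/-! ### The learning algorithm and its implementation -/

/-- The points of a finite family, extended by zero. -/
noncomputable def extendPoints {d N : ℕ} (Z : Fin N → EuclideanSpace ℝ (Fin d)) (i : ℕ) :
    EuclideanSpace ℝ (Fin d) :=
  if h : i < N then Z ⟨i, h⟩ else 0

/-! ### The program's memory follows the abstract learner. -/

namespace RealRAM

variable {d N : ℕ} {Q : EuclideanSpace ℝ (Fin d) → List (ℕ × ℝ) × ℕ}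

theorem holds_initStore (T : ℕ) (Z : Fin N → EuclideanSpace ℝ (Fin d)) :
    Holds T N (extendPoints Z) 0 0 0 (initStore T Z) where
  dim := by simp [initStore]
  horizon := by simp [initStore]
  size := by simp [initStore]
  points := by intro i hi l; simp [initStore, extendPoints, hi]
  obs := by intro l; simp [initStore]
  weights := by intro i _ j _; simp [initStore]
  dist := by intro i _; simp [initStore]

theorem Holds.observe {T : ℕ} {z : ℕ → EuclideanSpace ℝ (Fin d)} {y : EuclideanSpace ℝ (Fin d)}
    {E : ℕ → ℕ → ℝ} {μ : ℕ → ℝ} {s : Store} (h : Holds T N z y E μ s)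
    (y' : EuclideanSpace ℝ (Fin d)) : Holds T N z y' E μ (s.observe y') where
  dim := h.dim
  horizon := h.horizon
  size := h.size
  points := by intro i hi l; simpa [Store.observe] using h.points i hi l
  obs := by intro l; simp [Store.observe]
  weights := by intro i hi j hj; simpa [Store.observe] using h.weights i hi j hj
  dist := by intro i hi; simpa [Store.observe] using h.dist i hi

theorem holds_storeAfter (T : ℕ) (Z : Fin N → EuclideanSpace ℝ (Fin d))
    (ys : List (EuclideanSpace ℝ (Fin d))) :
    Holds T N (extendPoints Z) (stateAfter T N (extendPoints Z) ys).2.2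
      (stateAfter T N (extendPoints Z) ys).1 (stateAfter T N (extendPoints Z) ys).2.1
      (storeAfter learnerCmd Q (initStore T Z) ys) ∧
    (storeAfter learnerCmd Q (initStore T Z) ys).out = [] := by
  induction ys using List.reverseRecOn with
  | nil => exact ⟨holds_initStore T Z, rfl⟩
  | append_singleton ys y ih =>
    have hs : storeAfter learnerCmd Q (initStore T Z) (ys ++ [y]) =
        (learnerCmd.run Q (storeAfter learnerCmd Q (initStore T Z) ys)).1.observe y := by
      simp [storeAfter]
    rw [hs, stateAfter_append]
    -- Only the resulting store matters here, so any finite bound on the finitely many queries will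
    -- do; the oracle need not be efficient.
    obtain ⟨τ, hτ⟩ : ∃ τ, ∀ i < N, (Q (extendPoints Z i)).2 + (Q (extendPoints Z i)).1.length ≤ τ :=
      ⟨∑ i ∈ Finset.range N, ((Q (extendPoints Z i)).2 + (Q (extendPoints Z i)).1.length),
        fun i hi => Finset.single_le_sum
          (f := fun i => (Q (extendPoints Z i)).2 + (Q (extendPoints Z i)).1.length)
          (fun _ _ => Nat.zero_le _) (Finset.mem_range.2 hi)⟩
    have h := spec_learnerCmd ih.1 ih.2 rfl rfl (fun i hi => (Nat.le_add_right _ _).trans (hτ i hi))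
      (fun i hi => (Nat.le_add_left _ _).trans (hτ i hi))
    exact ⟨h.1.1.observe y, rfl⟩

/-- What the learner's program does in a round. -/
theorem spec_learnerCmd_round (T : ℕ) (Z : Fin N → EuclideanSpace ℝ (Fin d))
    (ys : List (EuclideanSpace ℝ (Fin d))) {τ : ℕ} (hτ : ∀ i < N, (Q (extendPoints Z i)).2 ≤ τ)
    (hlen : ∀ i < N, (Q (extendPoints Z i)).1.length ≤ τ) :
    Spec Q learnerCmd (storeAfter learnerCmd Q (initStore T Z) ys) (fun s =>
      s.out = (List.range N).flatMap fun k => (Q (extendPoints Z k)).1.map fun e =>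
        (e.1, playedDist T N (extendPoints Z) ys k * e.2)) (400 * (d + T + N + τ + 1) ^ 3) :=
  (spec_learnerCmd (holds_storeAfter T Z ys).1 (holds_storeAfter T Z ys).2 rfl rfl hτ hlen).imp
    fun _ h => h.2

end RealRAM

section Learner

variable {d n n' T N : ℕ} {G : StructuredGame d n n'} (D : DecompositionOracle G)
  {Z : Fin N → EuclideanSpace ℝ (Fin d)}

theorem extendPoints_mem (hZ : ∀ i, Z i ∈ G.K) {i : ℕ} (hi : i < N) : extendPoints Z i ∈ G.K := by
  rw [extendPoints, dif_pos hi]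
  exact hZ _

/-- The embeddings of the Adversary's previous mixed actions. -/
noncomputable def observations (G : StructuredGame d n n') {t : ℕ}
    (h : Fin t → stdSimplex ℝ (Fin n')) : List (EuclideanSpace ℝ (Fin d)) :=
  List.ofFn fun s => G.embedAdv (h s)

theorem norm_le_of_mem_observations {t : ℕ} (h : Fin t → stdSimplex ℝ (Fin n')) :
    ∀ y ∈ observations G h, ‖y‖ ≤ 1 := by
  intro y hy
  obtain ⟨s, rfl⟩ := List.mem_ofFn.1 hy
  exact G.norm_embedAdv_le _

/-- The learning algorithm: play the oracle's decompositions of the points of the discretization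
with the weights `playedDist`. -/
noncomputable def learner (T : ℕ) (hN : 0 < N) (hZ : ∀ i, Z i ∈ G.K) : LearningAlgorithm n n' T :=
  fun t h => ⟨D.mixture N (extendPoints Z)
      (playedDist T N (extendPoints Z) (observations G h)),
    D.mixture_mem (fun _ hk => extendPoints_mem hZ hk)
      (playedDist_nonneg hN (Nat.zero_lt_of_lt t.2)
        (fun _ hi => G.norm_le_of_mem_K (extendPoints_mem hZ hi)) _
        (norm_le_of_mem_observations h))
      (sum_playedDist hN (Nat.zero_lt_of_lt t.2)
        (fun _ hi => G.norm_le_of_mem_K (extendPoints_mem hZ hi)) _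
        (norm_le_of_mem_observations h))⟩

theorem implements_learner (hN : 0 < N) (hZ : ∀ i, Z i ∈ G.K) :
    RealRAM.Implements RealRAM.learnerCmd D Z (learner D T hN hZ) := by
  intro t h
  have hs := RealRAM.spec_learnerCmd_round (Q := D.toQuery) T Z (observations G h)
    (τ := ∑ i ∈ Finset.range N, D.time (extendPoints Z i))
    (fun i hi => Finset.single_le_sum (f := fun i => D.time (extendPoints Z i))
      (fun _ _ => Nat.zero_le _) (Finset.mem_range.2 hi))
    (fun i hi => by
      have h1 := D.length_le _ (extendPoints_mem hZ hi)
      refine le_trans ?_ (Finset.single_le_sum (f := fun i => D.time (extendPoints Z i))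
        (fun _ _ => Nat.zero_le _) (Finset.mem_range.2 hi))
      simpa [DecompositionOracle.toQuery] using h1)
  have h1 := hs.1
  rw [observations] at h1
  rw [h1]
  exact D.represents_mixture

theorem roundTimeLE_learner (hZ : ∀ i, Z i ∈ G.K) {τ : ℕ} (hτ : ∀ x ∈ G.K, D.time x ≤ τ) :
    RealRAM.RoundTimeLE RealRAM.learnerCmd D Z T (400 * (d + T + N + τ + 1) ^ 3) := by
  intro t h
  refine (RealRAM.spec_learnerCmd_round (Q := D.toQuery) T Z (observations G h)
    (fun i hi => hτ _ (extendPoints_mem hZ hi)) (fun i hi => ?_)).2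
  have h1 := D.length_le _ (extendPoints_mem hZ hi)
  have h2 := hτ _ (extendPoints_mem hZ hi)
  simpa [DecompositionOracle.toQuery] using h1.trans h2

/-! ### Swap regret of the learner -/

theorem swapRegret_le (hn : 0 < n) (p : Fin T → stdSimplex ℝ (Fin n))
    (q : Fin T → stdSimplex ℝ (Fin n')) {B : ℝ}
    (h : ∀ φ : Fin n → Fin n, ∑ t,
      (inner ℝ (∑ a, (p t : Fin n → ℝ) a • G.v (φ a)) (G.embedAdv (q t)) -
      inner ℝ (∑ a, (p t : Fin n → ℝ) a • G.v a) (G.embedAdv (q t))) ≤ B) :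
    G.swapRegret p q ≤ B := by
  have : Nonempty (Fin n) := ⟨⟨0, hn⟩⟩
  refine ciSup_le fun φ => ?_
  simp only [G.uLMixed_eq, StructuredGame.sum_swapMixed_smul]
  exact h φ

theorem norm_sum_smul_le_one (p : stdSimplex ℝ (Fin n)) (φ : Fin n → Fin n) :
    ‖∑ a, (p : Fin n → ℝ) a • G.v (φ a)‖ ≤ 1 := by
  refine G.norm_le_of_mem_K ?_
  exact (convex_convexHull ℝ _).sum_mem (fun a _ => p.2.1 a) p.2.2
    (fun a _ => subset_convexHull ℝ _ ⟨_, rfl⟩)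

/-- The trivial bound for swap regret. -/
theorem swapRegret_le_two_mul (hn : 0 < n) (p : Fin T → stdSimplex ℝ (Fin n))
    (q : Fin T → stdSimplex ℝ (Fin n')) : G.swapRegret p q ≤ 2 * T := by
  refine swapRegret_le hn p q fun φ => ?_
  calc _ ≤ ∑ t : Fin T, (2 : ℝ) := by
        refine Finset.sum_le_sum fun t _ => ?_
        have h1 := abs_le.1 (abs_inner_le_one (norm_sum_smul_le_one (G := G) (p t) φ)
          (G.norm_embedAdv_le (q t)))
        have h2 := abs_le.1 (abs_inner_le_one (norm_sum_smul_le_one (G := G) (p t) id)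
          (G.norm_embedAdv_le (q t)))
        simp only [id] at h2
        linarith [h1.2, h2.1]
    _ = 2 * T := by simp [mul_comm]

/-- Swap regret of the learner, when the support function of the discretization is within `ε` of
that of the Learner's actions. -/
theorem swapRegret_learner_le (hn : 0 < n) (hT : 0 < T) (hN : 0 < N) (hZ : ∀ i, Z i ∈ G.K) {ε : ℝ}
    (hε : 0 ≤ ε) (hnet : ∀ S : EuclideanSpace ℝ (Fin d), ∃ k, ∀ i,
      inner ℝ (G.v i) S ≤ inner ℝ (Z k) S + ε * ‖S‖)
    (q : Fin T → stdSimplex ℝ (Fin n')) :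
    G.swapRegret ((learner D T hN hZ).play q) q ≤
      N * Real.log N * inverseRate T N + 2 * T / inverseRate T N + 2 + ε * T := by
  set z := extendPoints Z with hz
  have hzK : ∀ k < N, z k ∈ G.K := fun k hk => extendPoints_mem hZ hk
  have hz1 : ∀ k < N, ‖z k‖ ≤ 1 := fun k hk => G.norm_le_of_mem_K (hzK k hk)
  set y : ℕ → EuclideanSpace ℝ (Fin d) :=
    fun t => if h : t < T then G.embedAdv (q ⟨t, h⟩) else 0 with hy
  have hy1 : ∀ t < T, ‖y t‖ ≤ 1 := by
    intro t ht
    simp only [hy, dif_pos ht]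
    exact G.norm_embedAdv_le _
  have hyt : ∀ t : Fin T, G.embedAdv (q t) = y t := fun t => by simp [hy]
  set μ : ℕ → ℕ → ℝ := fun t => playedDist T N z ((List.range t).map y) with hμ
  have hys : ∀ t ≤ T, ∀ x ∈ (List.range t).map y, ‖x‖ ≤ 1 := by
    intro t ht x hx
    obtain ⟨s, hs, rfl⟩ := List.mem_map.1 hx
    exact hy1 s (by have := List.mem_range.1 hs; omega)
  have hμ0 : ∀ t < T, ∀ k < N, 0 ≤ μ t k := fun t ht =>
    playedDist_nonneg hN hT hz1 _ (hys t ht.le)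
  have hμ1 : ∀ t < T, ∑ k ∈ Finset.range N, μ t k = 1 := fun t ht =>
    sum_playedDist hN hT hz1 _ (hys t ht.le)
  have hplay : ∀ t : Fin T, ((learner D T hN hZ).play q t : Fin n → ℝ) = D.mixture N z (μ t) := by
    intro t
    have : observations G (fun s : Fin t => q ⟨s, s.2.trans t.2⟩) = (List.range t).map y := by
      refine List.ext_getElem (by simp [observations]) fun i h1 h2 => ?_
      have hi : i < t := by simpa [observations] using h1
      simp [observations, hy, hi.trans t.2]
    simp only [LearningAlgorithm.play, learner, this, hμ, hz]
    rfl
  refine swapRegret_le hn _ q fun φ => ?_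
  -- The image of the point `k` under `φ`. It does not depend on the round because the oracle is a
  -- fixed map, so a swap of actions acts as a map on the points.
  set x : ℕ → EuclideanSpace ℝ (Fin d) := fun k => ∑ a, D.mixed (z k) a • G.v (φ a) with hx
  -- The observations charged to the point `k`. The weights of each round sum to one, so the norms
  -- of the `S k` sum to at most `T`.
  set S : ℕ → EuclideanSpace ℝ (Fin d) := fun k => ∑ t ∈ Finset.range T, μ t k • y t with hS
  have hSn : ∑ k ∈ Finset.range N, ‖S k‖ ≤ T := by
    calc ∑ k ∈ Finset.range N, ‖S k‖ ≤ ∑ k ∈ Finset.range N, ∑ t ∈ Finset.range T, μ t k := by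
          refine Finset.sum_le_sum fun k hk => (norm_sum_le _ _).trans ?_
          refine Finset.sum_le_sum fun t ht => ?_
          have h0 := hμ0 t (Finset.mem_range.1 ht) k (Finset.mem_range.1 hk)
          rw [norm_smul, Real.norm_of_nonneg h0]
          exact mul_le_of_le_one_right h0 (hy1 t (Finset.mem_range.1 ht))
      _ = T := by
          rw [Finset.sum_comm, Finset.sum_congr rfl fun t ht => hμ1 t (Finset.mem_range.1 ht)]
          simp
  have hreg : ∑ t, (inner ℝ (∑ a, ((learner D T hN hZ).play q t : Fin n → ℝ) a • G.v (φ a))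
        (G.embedAdv (q t)) - inner ℝ (∑ a, ((learner D T hN hZ).play q t : Fin n → ℝ) a • G.v a)
        (G.embedAdv (q t))) =
      ∑ k ∈ Finset.range N, inner ℝ (x k - z k) (S k) := by
    have h1 : ∀ t : Fin T,
        inner ℝ (∑ a, ((learner D T hN hZ).play q t : Fin n → ℝ) a • G.v (φ a)) (G.embedAdv (q t)) -
          inner ℝ (∑ a, ((learner D T hN hZ).play q t : Fin n → ℝ) a • G.v a) (G.embedAdv (q t)) =
        ∑ k ∈ Finset.range N, μ t k * inner ℝ (x k - z k) (y t) := by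
      intro t
      rw [hplay, D.sum_mixture_smul, D.sum_mixture_smul, hyt, ← inner_sub_left,
        ← Finset.sum_sub_distrib, sum_inner]
      refine Finset.sum_congr rfl fun k hk => ?_
      rw [D.sum_mixed_smul_v (hzK k (Finset.mem_range.1 hk)), ← smul_sub, real_inner_smul_left]
    rw [Finset.sum_congr rfl fun t _ => h1 t,
      ← Finset.sum_range fun t => ∑ k ∈ Finset.range N, μ t k * inner ℝ (x k - z k) (y t),
      Finset.sum_comm]
    refine Finset.sum_congr rfl fun k _ => ?_
    simp only [hS, inner_sum, real_inner_smul_right]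
  -- A linear functional on `K` is controlled by its values at the vertices. The condition `k < N`
  -- is inside the existential so that the chosen `f` has values below `N` everywhere.
  have hbest : ∀ k, ∃ j < N, k < N → inner ℝ (x k) (S k) ≤ inner ℝ (z j) (S k) + ε * ‖S k‖ := by
    intro k
    obtain ⟨j, hj⟩ := hnet (S k)
    refine ⟨j, j.2, fun hk => ?_⟩
    have hzj : z j = Z j := by simp [hz, extendPoints]
    have hm := D.mixed_mem (hzK k hk)
    simp only [hx, sum_inner, real_inner_smul_left]
    rw [hzj]
    calc ∑ a, D.mixed (z k) a * inner ℝ (G.v (φ a)) (S k)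
        ≤ ∑ a, D.mixed (z k) a * (inner ℝ (Z j) (S k) + ε * ‖S k‖) :=
          Finset.sum_le_sum fun a _ => mul_le_mul_of_nonneg_left (hj (φ a)) (hm.1 a)
      _ = _ := by rw [← Finset.sum_mul, hm.2, one_mul]
  choose f hf hfS using hbest
  have hmw := playedDist_swap_regret hN hT hz1 y hy1 f fun i _ => hf i
  have hmw' : ∑ k ∈ Finset.range N, inner ℝ (z (f k) - z k) (S k) ≤
      N * Real.log N * inverseRate T N + 2 * T / inverseRate T N + 2 := by
    refine le_trans (le_of_eq ?_) hmw
    refine Finset.sum_congr rfl fun k _ => ?_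
    simp only [hS, inner_sum, real_inner_smul_right, inner_sub_left]
    exact Finset.sum_congr rfl fun t _ => by simp only [hμ]; ring
  rw [hreg]
  have hfin : ∑ k ∈ Finset.range N, inner ℝ (x k - z k) (S k) ≤
      ∑ k ∈ Finset.range N, (inner ℝ (z (f k) - z k) (S k) + ε * ‖S k‖) := by
    refine Finset.sum_le_sum fun k hk => ?_
    have := hfS k (Finset.mem_range.1 hk)
    simp only [inner_sub_left]
    linarith
  rw [Finset.sum_add_distrib, ← Finset.mul_sum] at hfin
  have := mul_le_mul_of_nonneg_left hSn hε
  linarith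

end Learner

/-! ### Choice of the discretization -/

/-- The cost of the learner for a discretization with `N ≤ 2 (r/4)^m` points, where
`T = r^(m+4)`. -/
theorem regret_bound_numeric {T N m : ℕ} {r : ℝ} (hr : 1 ≤ r) (hT : (T : ℝ) = r ^ (m + 4))
    (hN : 0 < N) (hNr : (N : ℝ) ≤ 2 * (r / 4) ^ m) :
    N * Real.log N * inverseRate T N + 2 * T / inverseRate T N + 2 ≤
      10 * (r ^ (m + 2) * (1 + Real.log r)) := by
  have hlr : 0 ≤ Real.log r := Real.log_nonneg hr
  -- `V` is the scale of `√(N T)`: the factor `4^(-m)` in the bound for `N` becomes `2^(-m)`, which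
  -- pays for the factor `m` in `log N`.
  set V := r ^ (m + 2) / 2 ^ m with hV
  have hV0 : 0 < V := by positivity
  have hN0 : (1 : ℝ) ≤ N := by exact_mod_cast hN
  have hk2 : (2 : ℝ) ≤ inverseRate T N := by exact_mod_cast two_le_inverseRate T N
  have hkT : (T : ℝ) ≤ inverseRate T N * inverseRate T N * N := by
    exact_mod_cast le_inverseRate_sq T hN
  have hkor : (inverseRate T N : ℝ) = 2 ∨
      ((inverseRate T N : ℝ) - 1) * (inverseRate T N - 1) * N < T := by
    rcases inverseRate_eq_two_or T N with h | h
    · left; exact_mod_cast h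
    · right
      have h1 : ((inverseRate T N - 1 : ℕ) : ℝ) = inverseRate T N - 1 := by
        rw [Nat.cast_sub ((two_le_inverseRate T N).trans' (by norm_num))]; simp
      rw [← h1]; exact_mod_cast h
  set k : ℝ := (inverseRate T N : ℝ)
  have hNT : (N : ℝ) * T ≤ 2 * V ^ 2 := by
    calc (N : ℝ) * T ≤ 2 * (r / 4) ^ m * T := by gcongr
      _ = 2 * V ^ 2 := by
          have h4 : (4 : ℝ) ^ m = (2 ^ m) ^ 2 := by rw [← pow_mul, mul_comm m, pow_mul]; norm_num
          rw [hT, hV, div_pow, div_pow, h4]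
          ring
  have hNle : (N : ℝ) ≤ 2 * T := by
    refine hNr.trans ?_
    rw [hT]
    gcongr
    calc (r / 4) ^ m ≤ r ^ m := by gcongr; linarith
      _ ≤ r ^ (m + 4) := pow_le_pow_right₀ hr (by omega)
  have hT0 : (0 : ℝ) ≤ T := Nat.cast_nonneg T
  have hTk : T / k ≤ 2 * V := by
    rw [div_le_iff₀ (by linarith)]
    refine (sq_le_sq₀ hT0 (by positivity)).1 ?_
    calc (T : ℝ) ^ 2 = T * T := sq _
      _ ≤ T * (k * k * N) := by gcongr
      _ = k ^ 2 * (N * T) := by ring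
      _ ≤ k ^ 2 * (2 * V ^ 2) := by gcongr
      _ ≤ (2 * V * k) ^ 2 := by nlinarith [sq_nonneg (V * k)]
  have hNk : N * k ≤ 4 * V := by
    refine (sq_le_sq₀ (by positivity) (by positivity)).1 ?_
    rcases hkor with h | h
    · rw [h]; nlinarith
    · have h1 : k ≤ 2 * (k - 1) := by linarith
      have h2 : k ^ 2 ≤ 4 * ((k - 1) * (k - 1)) := by nlinarith
      have h3 : k ^ 2 * N ≤ 4 * T := by nlinarith
      calc ((N : ℝ) * k) ^ 2 = (N : ℝ) * (k ^ 2 * N) := by ring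
        _ ≤ (N : ℝ) * (4 * T) := by gcongr
        _ ≤ (4 * V) ^ 2 := by nlinarith [sq_nonneg V]
  have hlogN : Real.log N ≤ 1 + m * Real.log r := by
    have h1 : (N : ℝ) ≤ 2 * r ^ m := by
      refine hNr.trans ?_
      gcongr
      linarith
    have h2 := Real.log_le_log (by linarith) h1
    rw [Real.log_mul (by norm_num) (by positivity), Real.log_pow] at h2
    have := Real.log_two_lt_d9
    linarith
  have hm : (m : ℝ) ≤ 2 ^ m := by exact_mod_cast Nat.lt_two_pow_self.le
  have hone : (1 : ℝ) ≤ 2 ^ m := one_le_pow₀ (by norm_num)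
  have hR : (1 : ℝ) ≤ r ^ (m + 2) := one_le_pow₀ hr
  have hVm : V * 2 ^ m = r ^ (m + 2) := by rw [hV]; field_simp
  have hVle : V ≤ r ^ (m + 2) := by nlinarith
  have h1 : N * Real.log N * k ≤ 4 * (r ^ (m + 2) * (1 + Real.log r)) := by
    have e2 : 1 + m * Real.log r ≤ 2 ^ m * (1 + Real.log r) := by nlinarith
    calc N * Real.log N * k = (N * k) * Real.log N := by ring
      _ ≤ (4 * V) * (2 ^ m * (1 + Real.log r)) := by
          have := Real.log_nonneg hN0
          exact mul_le_mul hNk (hlogN.trans e2) this (by positivity)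
      _ = 4 * (V * 2 ^ m * (1 + Real.log r)) := by ring
      _ = _ := by rw [hVm]
  have h2 : 2 * T / k ≤ 4 * V := by
    rw [mul_div_assoc]; linarith
  have h3 : r ^ (m + 2) ≤ r ^ (m + 2) * (1 + Real.log r) := by nlinarith
  linarith

/-- For every game there is a discretization for which the learner has small swap regret. -/
theorem exists_discretization {d n n' T : ℕ} (hn : 0 < n) (hT : 0 < T) (G : StructuredGame d n n')
    {r : ℝ} (hr : 1 ≤ r) (hrT : (T : ℝ) = r ^ (d + 3)) :
    ∃ (N : ℕ) (Z : Fin N → EuclideanSpace ℝ (Fin d)) (hN : 0 < N) (hZ : ∀ i, Z i ∈ G.K),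
      N ≤ 2 * T + 1 ∧ ∀ (D : DecompositionOracle G) (q : Fin T → stdSimplex ℝ (Fin n')),
        G.swapRegret ((learner D T hN hZ).play q) q ≤ 1152 * (r ^ (d + 1) * (1 + Real.log r)) := by
  have hlr : 0 ≤ Real.log r := Real.log_nonneg hr
  have hvK : ∀ i, G.v i ∈ G.K := fun i => subset_convexHull ℝ _ ⟨i, rfl⟩
  have hR : (1 : ℝ) ≤ r ^ (d + 1) := one_le_pow₀ hr
  have hR2 : r ^ (d + 1) ≤ r ^ (d + 1) * (1 + Real.log r) := by nlinarith
  rcases Nat.eq_zero_or_pos d with rfl | hd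
  · refine ⟨1, fun _ => G.v ⟨0, hn⟩, one_pos, fun _ => hvK _, by omega, fun D q => ?_⟩
    refine (swapRegret_le (B := 0) hn _ q fun φ => ?_).trans (by positivity)
    simp [PiLp.inner_apply]
  -- For `r < 24` the mesh `24 / r` would exceed `1`. The trivial bound `2T ≤ 2 · 24² r^(d+1)` then
  -- suffices, and `2 · 24² = 1152` is the constant.
  rcases lt_or_ge r 24 with hr24 | hr24
  · refine ⟨1, fun _ => G.v ⟨0, hn⟩, one_pos, fun _ => hvK _, by omega, fun D q => ?_⟩
    refine (swapRegret_le_two_mul hn _ q).trans ?_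
    have h1 : (T : ℝ) = r ^ (d + 1) * r ^ 2 := by rw [hrT]; ring
    have h2 : r ^ 2 ≤ 576 := by nlinarith
    rw [h1]
    nlinarith
  obtain ⟨m, rfl⟩ : ∃ m, d = m + 1 := ⟨d - 1, by omega⟩
  have hr0 : 0 < r := by linarith
  -- With `δ = 24 / r` the packing bound is `2 (m + 1) (r / 8)^m`; half of the base absorbs `m + 1 ≤
  -- 2^m`, leaving `2 (r / 4)^m`.
  obtain ⟨s, hsv, hscard, hsnet⟩ := exists_small_support_net hd hn G.v G.norm_v_le
    (δ := 24 / r) (by positivity) ((div_le_one hr0).2 hr24)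
  have hsN : (s.card : ℝ) ≤ 2 * (r / 4) ^ m := by
    refine hscard.trans ?_
    have h1 : (3 : ℝ) / (24 / r) = r / 4 / 2 := by field_simp; norm_num
    have h2 : ((m + 1 : ℕ) : ℝ) ≤ 2 ^ m := by exact_mod_cast Nat.lt_two_pow_self
    rw [h1, Nat.add_sub_cancel, div_pow (r / 4)]
    calc 2 * ((m + 1 : ℕ) : ℝ) * ((r / 4) ^ m / 2 ^ m)
        ≤ 2 * 2 ^ m * ((r / 4) ^ m / 2 ^ m) := by gcongr
      _ = 2 * (r / 4) ^ m := by field_simp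
  have hs0 : 0 < s.card := by
    obtain ⟨z, hz, _⟩ := hsnet 0
    exact Finset.card_pos.2 ⟨z, hz⟩
  have hZ : ∀ i, ((s.equivFin.symm i : s) : EuclideanSpace ℝ (Fin (m + 1))) ∈ G.K := by
    intro i
    obtain ⟨j, hj⟩ := hsv _ (s.equivFin.symm i).2
    rw [← hj]
    exact hvK j
  refine ⟨s.card, fun i => (s.equivFin.symm i : s), hs0, hZ, ?_, fun D q => ?_⟩
  · have : (s.card : ℝ) ≤ 2 * T := by
      refine hsN.trans ?_
      rw [hrT]
      gcongr
      calc (r / 4) ^ m ≤ r ^ m := by gcongr; linarith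
        _ ≤ r ^ (m + 1 + 3) := pow_le_pow_right₀ hr (by omega)
    have : s.card ≤ 2 * T := by exact_mod_cast this
    omega
  · have hreg := swapRegret_learner_le D hn hT hs0 hZ (ε := (24 / r) ^ 2) (by positivity) (by
      intro S
      obtain ⟨z, hz, h⟩ := hsnet S
      exact ⟨s.equivFin ⟨z, hz⟩, by simpa using h⟩) q
    have hnum := regret_bound_numeric hr hrT hs0 hsN
    have hε : (24 / r) ^ 2 * T = 576 * r ^ (m + 2) := by
      rw [hrT]; field_simp; ring
    rw [hε] at hreg
    have e : r ^ (m + 1 + 1) = r ^ (m + 2) := rfl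
    rw [e] at hR2 ⊢
    linarith

/-! ### Asymptotics -/

/-- Write `r² = Y X₀` with `X₀` the threshold. Then `ε r²` is `2^20 Y log (2 / ε)`, whereas `log r`
is at most linear in `Y` and in `log (2 / ε)`. -/
theorem one_add_log_le_mul_sq {ε r : ℝ} (hε : 0 < ε) (hε1 : ε ≤ 1)
    (hr : 1 ≤ r) (h : 2 ^ 20 / ε * Real.log (2 / ε) ≤ r ^ 2) :
    1152 * (1 + Real.log r) ≤ ε * r ^ 2 := by
  have hl2 := Real.log_two_gt_d9
  have hl2' := Real.log_two_lt_d9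
  set L := Real.log (2 / ε) with hL
  have hLe : L = Real.log 2 + Real.log ε⁻¹ := by
    rw [hL, div_eq_mul_inv, Real.log_mul (by norm_num) (by positivity)]
  have hε' : 0 ≤ Real.log ε⁻¹ := Real.log_nonneg ((one_le_inv₀ hε).2 hε1)
  have hL2 : 0.69 ≤ L := by linarith
  have hL0 : 0 < L := by linarith
  set X₀ := 2 ^ 20 / ε * L with hX₀
  have hinv : 1 ≤ ε⁻¹ := (one_le_inv₀ hε).2 hε1
  have hX1 : 1 ≤ X₀ := by
    rw [hX₀, div_eq_mul_inv]
    nlinarith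
  have hX0 : 0 < X₀ := by linarith
  -- `14` bounds `20 log 2`; one `L` pays for `log ε⁻¹`, the other for `log L`.
  have hlogX₀ : Real.log X₀ ≤ 14 + 2 * L := by
    rw [hX₀, div_eq_mul_inv, Real.log_mul (by positivity) hL0.ne',
      Real.log_mul (by norm_num) (by positivity), Real.log_pow]
    have := Real.log_le_sub_one_of_pos hL0
    push_cast
    linarith
  have hlogX₀' : 0 ≤ Real.log X₀ := Real.log_nonneg hX1
  set Y := r ^ 2 / X₀ with hY
  have hY1 : 1 ≤ Y := (one_le_div hX0).2 h
  have hr2 : r ^ 2 = Y * X₀ := by rw [hY]; field_simp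
  have hlogr : 2 * Real.log r = Real.log Y + Real.log X₀ := by
    rw [← Real.log_mul (by positivity) hX0.ne', ← hr2, Real.log_pow]; norm_num
  have hlogY := Real.log_le_sub_one_of_pos (show 0 < Y by linarith)
  have hlr := Real.log_nonneg hr
  have h1 : 1 + Real.log r ≤ Y * (15 + 2 * L) := by nlinarith
  have h2 : ε * r ^ 2 = Y * (2 ^ 20 * L) := by
    rw [hr2, hX₀]; field_simp
  rw [h2]
  calc 1152 * (1 + Real.log r) ≤ 1152 * (Y * (15 + 2 * L)) := by gcongr
    _ = Y * (1152 * (15 + 2 * L)) := by ring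
    _ ≤ Y * (2 ^ 20 * L) := mul_le_mul_of_nonneg_left (by linarith) (by linarith)

/-- The same number serves as coefficient and as exponent, hence the sum of the two required values.
-/
theorem time_bound_numeric {d T N : ℕ} (a : ℕ) (hN : N ≤ 2 * T + 1) :
    400 * (d + T + N + a * (d + 1) ^ a + 1) ^ 3 ≤
      (400 * (a + 3) ^ 3 + 3 * (a + 1)) * (d + T + 1) ^ (400 * (a + 3) ^ 3 + 3 * (a + 1)) := by
  set M := d + T + 1 with hM
  have hM1 : 1 ≤ M := by omega
  have h1 : d + T + N + a * (d + 1) ^ a + 1 ≤ (a + 3) * M ^ (a + 1) := by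
    have e1 : (d + 1) ^ a ≤ M ^ (a + 1) :=
      (Nat.pow_le_pow_left (by omega) a).trans (Nat.pow_le_pow_right hM1 (by omega))
    have e2 : M ≤ M ^ (a + 1) := Nat.le_self_pow (by omega) M
    calc d + T + N + a * (d + 1) ^ a + 1 ≤ 3 * M + a * (d + 1) ^ a := by omega
      _ ≤ 3 * M ^ (a + 1) + a * M ^ (a + 1) := by gcongr
      _ = _ := by ring
  calc 400 * (d + T + N + a * (d + 1) ^ a + 1) ^ 3 ≤ 400 * ((a + 3) * M ^ (a + 1)) ^ 3 := by gcongr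
    _ = 400 * (a + 3) ^ 3 * M ^ (3 * (a + 1)) := by rw [mul_pow, ← pow_mul]; ring
    _ ≤ _ := Nat.mul_le_mul (by omega) (Nat.pow_le_pow_right hM1 (by omega))

/-! ### The main theorem. -/

theorem theorem1 :
    ∃ (C : ℝ) (P : RealRAM.Cmd) (κ : ℕ) (β : ℕ → ℕ), 0 < C ∧
      ∀ (d n n' T : ℕ) (_hn : 0 < n) (G : StructuredGame d n n'),
        ∃ (N : ℕ) (Z : Fin N → EuclideanSpace ℝ (Fin d)),
          N ≤ κ * (d + T + 1) ^ κ ∧ (∀ i, Z i ∈ G.K) ∧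
          ∀ D : DecompositionOracle G, ∃ A : LearningAlgorithm n n' T,
            RealRAM.Implements P D Z A ∧
            (∀ a : ℕ, (∀ x ∈ G.K, D.time x ≤ a * (d + 1) ^ a) →
              RealRAM.RoundTimeLE P D Z T (β a * (d + T + 1) ^ β a)) ∧
            (∀ q : Fin T → stdSimplex ℝ (Fin n'),
              G.swapRegret (A.play q) q ≤
                C * (T : ℝ) ^ (((d : ℝ) + 1) / ((d : ℝ) + 3)) * Real.log ((T : ℝ) + 1)) ∧
            (∀ ε : ℝ, 0 < ε → ε ≤ 1 →
              (C / ε * Real.log (2 / ε)) ^ (((d : ℝ) + 3) / 2) ≤ (T : ℝ) →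
              ∀ q : Fin T → stdSimplex ℝ (Fin n'),
                G.swapRegret (A.play q) q ≤ ε * (T : ℝ)) := by
  refine ⟨2 ^ 20, RealRAM.learnerCmd, 3, fun a => 400 * (a + 3) ^ 3 + 3 * (a + 1), by norm_num,
    fun d n n' T hn G => ?_⟩
  have hκ : ∀ N, N ≤ 2 * T + 1 → N ≤ 3 * (d + T + 1) ^ 3 := by
    intro N hN
    have : d + T + 1 ≤ (d + T + 1) ^ 3 := Nat.le_self_pow (by norm_num) _
    omega
  -- For `T = 0` the scale `r` would be `0` instead of at least `1`; the trivial bound `2T` is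
  -- already zero.
  rcases Nat.eq_zero_or_pos T with rfl | hT
  · have hZ : ∀ _ : Fin 1, G.v ⟨0, hn⟩ ∈ G.K := fun _ => subset_convexHull ℝ _ ⟨_, rfl⟩
    refine ⟨1, fun _ => G.v ⟨0, hn⟩, hκ 1 (by omega), hZ, fun D => ⟨learner D 0 one_pos hZ,
      implements_learner D one_pos hZ, fun a ha t => t.elim0, fun q => ?_, fun ε _ _ _ q => ?_⟩⟩
    · simpa using swapRegret_le_two_mul hn ((learner D 0 one_pos hZ).play q) q
    · simpa using swapRegret_le_two_mul hn ((learner D 0 one_pos hZ).play q) q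
  have hT1 : (1 : ℝ) ≤ T := by exact_mod_cast hT
  set r : ℝ := (T : ℝ) ^ (1 / ((d : ℝ) + 3)) with hr
  have hd3 : (0 : ℝ) < (d : ℝ) + 3 := by positivity
  have hr1 : 1 ≤ r := Real.one_le_rpow hT1 (by positivity)
  have hpow : ∀ k : ℕ, r ^ k = (T : ℝ) ^ ((k : ℝ) / ((d : ℝ) + 3)) := by
    intro k
    rw [hr, ← Real.rpow_mul_natCast (by positivity)]
    congr 1
    field_simp
  have hrT : (T : ℝ) = r ^ (d + 3) := by
    rw [hpow]; push_cast; rw [div_self hd3.ne', Real.rpow_one]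
  obtain ⟨N, Z, hN, hZ, hNT, hreg⟩ := exists_discretization hn hT G hr1 hrT
  refine ⟨N, Z, hκ N hNT, hZ, fun D => ⟨learner D T hN hZ, implements_learner D hN hZ,
    fun a ha t h => ((roundTimeLE_learner D hZ ha) t h).trans (time_bound_numeric a hNT),
    fun q => (hreg D q).trans ?_, fun ε hε hε1 hεT q => (hreg D q).trans ?_⟩⟩
  · have h1 : r ^ (d + 1) = (T : ℝ) ^ (((d : ℝ) + 1) / ((d : ℝ) + 3)) := by
      rw [hpow]; push_cast; rfl
    -- Lets `log (T + 1)` absorb the summand `1` in `1 + log r`, down to `T = 1`.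
    have hlog2 : (1 : ℝ) / 2 ≤ Real.log (T + 1) := by
      have := Real.log_le_log (by norm_num : (0 : ℝ) < 2) (by linarith : (2 : ℝ) ≤ T + 1)
      linarith [Real.log_two_gt_d9]
    have hlogr : Real.log r ≤ Real.log (T + 1) := by
      refine Real.log_le_log (by linarith) ?_
      have : r ≤ T := by
        rw [hrT]; exact le_self_pow₀ hr1 (by omega)
      linarith
    rw [← h1, mul_assoc]
    have hR : 0 < r ^ (d + 1) := by positivity
    have h2 : 1152 * (1 + Real.log r) ≤ 2 ^ 20 * Real.log (T + 1) := by linarith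
    nlinarith
  · have hX : 2 ^ 20 / ε * Real.log (2 / ε) ≤ r ^ 2 := by
      have hL : 0 ≤ Real.log (2 / ε) := Real.log_nonneg (by rw [le_div_iff₀ hε]; linarith)
      have h0 : 0 ≤ 2 ^ 20 / ε * Real.log (2 / ε) := by positivity
      have h1 := Real.rpow_le_rpow (by positivity) hεT
        (by positivity : 0 ≤ 2 / ((d : ℝ) + 3))
      rw [← Real.rpow_mul h0] at h1
      have h2 : ((d : ℝ) + 3) / 2 * (2 / ((d : ℝ) + 3)) = 1 := by field_simp
      rw [h2, Real.rpow_one] at h1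
      rw [hpow]
      exact_mod_cast h1
    have h := one_add_log_le_mul_sq hε hε1 hr1 hX
    have hR : 0 < r ^ (d + 1) := by positivity
    calc 1152 * (r ^ (d + 1) * (1 + Real.log r))
        = r ^ (d + 1) * (1152 * (1 + Real.log r)) := by ring
      _ ≤ r ^ (d + 1) * (ε * r ^ 2) := by gcongr
      _ = ε * r ^ (d + 3) := by ring
      _ = ε * T := by rw [← hrT]
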